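/- Let $p,q,r$ be real numbers with $q>0$, $0<r<\frac1q$ and $p>\max\{1,\frac1q\}$. For $\lambda>0$ consider the system $$-u''=\lambda|v|^{r-1}v+|v|^{p-1}v,\qquad -v''=|u|^{q-1}u\quad\text{in }(0,1),\qquad u(0)=u(1)=v(0)=v(1)=0.\tag{S}$$ A nonnegative classical solution of (S) is a pair $u,v\in C^2(0,1)\cap C[0,1]$ with $u,v\ge 0$ in $(0,1)$ that satisfies (S) pointwise. Let $X=W^{2,\frac{q+1}{q}}(0,1)\cap W^{1,\frac{q+1}{q}}_0(0,1)$, normed by $\|v\|_X=\|v''\|_{L^{(q+1)/q}(0,1)}$, and for $v\in X$ let $$J_\lambda(v)=\frac{q}{q+1}\int_0^1|v''|^{\frac{q+1}{q}}\,dx-\frac{\lambda}{r+1}\int_0^1 v_+^{r+1}\,dx-\frac1{p+1}\int_0^1 v_+^{p+1}\,dx,\qquad v_+=\max\{v,0\}.$$ Then there are constants $\lambda_0>0$ and $T>0$ such that for every $\lambda\in(0,\lambda_0)$ the system (S) has two distinct nontrivial nonnegative classical solutions $(u_1,v_1)$ and $(u_2,v_2)$, with $v_1,v_2\in X$, such that: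 (i) $v_1$ is a mountain pass critical point of $J_\lambda$ with positive energy: there are $C>0$ and $e\in X$ with $\|e\|_X>T$, $J_\lambda(e)<0$ and $J_\lambda(w)\ge C$ whenever $\|w\|_X=T$; $J_\lambda$ is Fréchet differentiable at $v_1$ with $DJ_\lambda(v_1)=0$; and $$J_\lambda(v_1)=\inf_{\gamma\in\Gamma}\ \max_{0\le t\le 1}J_\lambda(\gamma(t))>0,\qquad \Gamma=\{\gamma\in C([0,1];X):\gamma(0)=0,\ \gamma(1)=e\};$$ (ii) $v_2$ is a local minimizer of $J_\lambda$ in $X$ with negative energy: $\|v_2\|_X<T$, $J_\lambda(v_2)=\min_{\|w\|_X\le T}J_\lambda(w)<0$. -/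

import Mathlib

open MeasureTheory Set Filter Topology
open scoped ContDiff ENNReal

noncomputable section

namespace HamSys

/-- Lebesgue measure on the open interval `(0,1)`. -/
abbrev mu : Measure ℝ := volume.restrict (Ioo (0 : ℝ) 1)

/-- A function in `C[0,1]`, read as a function on `ℝ` (continued by its boundary values; only its
values on `[0,1]` are ever used). -/
def ext (f : C(unitInterval, ℝ)) : ℝ → ℝ := IccExtend zero_le_one f

/-- Test functions on `(0,1)`: the functions of class `C_c^∞(0,1)`. -/
structure IsTest (φ : ℝ → ℝ) : Prop where
  smooth : ContDiff ℝ ∞ φ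
  compact : HasCompactSupport φ
  supp : tsupport φ ⊆ Ioo 0 1

/-- `g` is the weak derivative of `f` in `(0,1)`. -/
def IsWeakDeriv (f g : ℝ → ℝ) : Prop :=
  ∀ φ : ℝ → ℝ, IsTest φ →
    ∫ x in Ioo (0 : ℝ) 1, f x * deriv φ x = - ∫ x in Ioo (0 : ℝ) 1, g x * φ x

/-! ### Facts on weak derivatives needed to see that the norm of `X` is well defined -/

theorem IsTest.deriv {φ : ℝ → ℝ} (h : IsTest φ) : IsTest (deriv φ) :=
  ⟨h.smooth.iterate_deriv 1, h.compact.deriv, (tsupport_deriv_subset).trans h.supp⟩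

theorem IsTest.integrable_mul {φ f : ℝ → ℝ} (h : IsTest φ) (hf : Integrable f mu) :
    Integrable (fun x => f x * φ x) mu := by
  obtain ⟨C, hC⟩ := h.compact.exists_bound_of_continuous h.smooth.continuous
  exact hf.mul_bdd (c := C) h.smooth.continuous.aestronglyMeasurable (ae_of_all _ hC)

theorem IsTest.integrable {φ : ℝ → ℝ} (h : IsTest φ) : Integrable φ mu :=
  (h.smooth.continuous.integrable_of_hasCompactSupport h.compact).restrict

/-- Fundamental lemma of the calculus of variations on `(0,1)`. -/
theorem ae_zero_of_test {f : ℝ → ℝ} (hf : Integrable f mu)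
    (h : ∀ φ, IsTest φ → ∫ x in Ioo (0 : ℝ) 1, f x * φ x = 0) : f =ᵐ[mu] 0 := by
  have hf' : IntegrableOn f (Ioo 0 1) volume := hf
  have := isOpen_Ioo.ae_eq_zero_of_integral_contDiff_smul_eq_zero
    hf'.locallyIntegrableOn (fun g h1 h2 h3 => by
      rw [← h g ⟨h1, h2, h3⟩]
      symm
      simp only [smul_eq_mul, mul_comm (g _)]
      apply setIntegral_eq_integral_of_forall_compl_eq_zero
      intro x hx
      rw [image_eq_zero_of_notMem_tsupport (fun hx' => hx (h3 hx')), mul_zero])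
  exact (ae_restrict_iff' measurableSet_Ioo).2 this

theorem IsWeakDeriv.unique {f g h : ℝ → ℝ} (hg : Integrable g mu) (hh : Integrable h mu)
    (h1 : IsWeakDeriv f g) (h2 : IsWeakDeriv f h) : g =ᵐ[mu] h := by
  have := ae_zero_of_test (hg.sub hh) (fun φ hφ => by
    have e1 := h1 φ hφ
    have e2 := h2 φ hφ
    simp only [Pi.sub_apply, sub_mul]
    rw [integral_sub (hφ.integrable_mul hg) (hφ.integrable_mul hh)]
    linarith)
  filter_upwards [this] with x hx
  simpa [sub_eq_zero] using hx

theorem IsWeakDeriv.congr {f f' g g' : ℝ → ℝ} (h : IsWeakDeriv f g) (hf : f =ᵐ[mu] f')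
    (hg : g =ᵐ[mu] g') : IsWeakDeriv f' g' := by
  intro φ hφ
  have e1 : ∫ x in Ioo (0 : ℝ) 1, f' x * _root_.deriv φ x
      = ∫ x in Ioo (0 : ℝ) 1, f x * _root_.deriv φ x := by
    apply integral_congr_ae; filter_upwards [hf] with x hx; rw [hx]
  have e2 : ∫ x in Ioo (0 : ℝ) 1, g' x * φ x = ∫ x in Ioo (0 : ℝ) 1, g x * φ x := by
    apply integral_congr_ae; filter_upwards [hg] with x hx; rw [hx]
  rw [e1, e2]; exact h φ hφ

theorem IsWeakDeriv.add {f f' g g' : ℝ → ℝ} (hf : Integrable f mu) (hf' : Integrable f' mu)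
    (hg : Integrable g mu) (hg' : Integrable g' mu)
    (h : IsWeakDeriv f g) (h' : IsWeakDeriv f' g') : IsWeakDeriv (f + f') (g + g') := by
  intro φ hφ
  simp only [Pi.add_apply, add_mul]
  rw [integral_add (hφ.deriv.integrable_mul hf) (hφ.deriv.integrable_mul hf'),
    integral_add (hφ.integrable_mul hg) (hφ.integrable_mul hg'), h φ hφ, h' φ hφ]
  ring

theorem IsWeakDeriv.smul {f g : ℝ → ℝ} (c : ℝ) (h : IsWeakDeriv f g) :
    IsWeakDeriv (c • f) (c • g) := by
  intro φ hφ
  simp only [Pi.smul_apply, smul_eq_mul, mul_assoc]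
  rw [integral_const_mul, integral_const_mul, h φ hφ]
  ring

theorem exists_test_integral_one : ∃ ψ : ℝ → ℝ, IsTest ψ ∧ ∫ x in Ioo (0 : ℝ) 1, ψ x = 1 := by
  let b : ContDiffBump (1 / 2 : ℝ) := ⟨1 / 8, 1 / 4, by norm_num, by norm_num⟩
  have hs : tsupport (b.normed volume) ⊆ Ioo (0 : ℝ) 1 := by
    rw [b.tsupport_normed_eq, Real.closedBall_eq_Icc]
    intro x hx
    simp only [b, mem_Icc] at hx
    constructor <;> linarith [hx.1, hx.2]
  refine ⟨b.normed volume, ⟨b.contDiff_normed, b.hasCompactSupport_normed, hs⟩, ?_⟩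
  rw [setIntegral_eq_integral_of_forall_compl_eq_zero, b.integral_normed]
  intro x hx
  exact image_eq_zero_of_notMem_tsupport (fun h => hx (hs h))

theorem exists_primitive {θ : ℝ → ℝ} (hθ : IsTest θ) (h0 : ∫ x in Ioo (0 : ℝ) 1, θ x = 0) :
    ∃ η, IsTest η ∧ deriv η = θ := by
  have hc : Continuous θ := hθ.smooth.continuous
  have hd : ∀ x, HasDerivAt (fun y => ∫ t in (0 : ℝ)..y, θ t) (θ x) x := fun x =>
    intervalIntegral.integral_hasDerivAt_right (hc.intervalIntegrable _ _)
      (hc.stronglyMeasurableAtFilter _ _) hc.continuousAt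
  have hde : _root_.deriv (fun y => ∫ t in (0 : ℝ)..y, θ t) = θ := funext fun x => (hd x).deriv
  obtain ⟨a, b, ha, hb, hab, hK⟩ : ∃ a b : ℝ, 0 < a ∧ b < 1 ∧ a ≤ b ∧ tsupport θ ⊆ Icc a b := by
    rcases (tsupport θ).eq_empty_or_nonempty with he | hne
    · exact ⟨1 / 2, 1 / 2, by norm_num, by norm_num, le_rfl, by simp [he]⟩
    · have hk : IsCompact (tsupport θ) := hθ.compact
      obtain ⟨a, ha⟩ := hk.exists_isLeast hne
      obtain ⟨b, hb⟩ := hk.exists_isGreatest hne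
      exact ⟨a, b, (hθ.supp ha.1).1, (hθ.supp hb.1).2, ha.2 hb.1, fun x hx => ⟨ha.2 hx, hb.2 hx⟩⟩
  have hz : ∀ x, x ∉ Icc a b → θ x = 0 := fun x hx =>
    image_eq_zero_of_notMem_tsupport (fun h => hx (hK h))
  have h01 : ∫ t in (0 : ℝ)..1, θ t = 0 := by
    rw [intervalIntegral.integral_of_le zero_le_one, integral_Ioc_eq_integral_Ioo, h0]
  have hsub : tsupport (fun y => ∫ t in (0 : ℝ)..y, θ t) ⊆ Icc a b := by
    refine closure_minimal ?_ isClosed_Icc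
    intro x hx
    by_contra hxn
    apply hx
    rcases lt_or_ge x a with hxa | hxa
    · show ∫ t in (0 : ℝ)..x, θ t = 0
      apply intervalIntegral.integral_zero_ae
      refine ae_of_all _ fun t ht => hz t fun h => ?_
      have := ht.2
      have : t < a := lt_of_le_of_lt this (max_lt ha hxa)
      exact absurd h.1 (not_le.2 this)
    · have hxb : b < x := by
        by_contra hh
        exact hxn ⟨hxa, not_lt.1 hh⟩
      show ∫ t in (0 : ℝ)..x, θ t = 0
      rw [← intervalIntegral.integral_add_adjacent_intervals (hc.intervalIntegrable 0 1)
        (hc.intervalIntegrable 1 x), h01, zero_add]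
      apply intervalIntegral.integral_zero_ae
      refine ae_of_all _ fun t ht => hz t fun h => ?_
      have := ht.1
      have : b < t := lt_of_le_of_lt (le_min hb.le hxb.le) this
      exact absurd h.2 (not_le.2 this)
  refine ⟨fun y => ∫ t in (0 : ℝ)..y, θ t, ⟨?_, ?_, ?_⟩, hde⟩
  · rw [contDiff_infty_iff_deriv]
    exact ⟨fun x => (hd x).differentiableAt, by rw [hde]; exact hθ.smooth⟩
  · exact isCompact_Icc.of_isClosed_subset (isClosed_tsupport _) hsub
  · exact hsub.trans (fun x hx => ⟨ha.trans_le hx.1, hx.2.trans_lt hb⟩)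

/-- A function with vanishing weak derivative is constant. -/
theorem IsWeakDeriv.ae_const {f g : ℝ → ℝ} (hf : Integrable f mu) (h : IsWeakDeriv f g)
    (hg : g =ᵐ[mu] 0) : ∃ c : ℝ, f =ᵐ[mu] fun _ => c := by
  obtain ⟨ψ, hψ, hψ1⟩ := exists_test_integral_one
  refine ⟨∫ x in Ioo (0 : ℝ) 1, f x * ψ x, ?_⟩
  set c := ∫ x in Ioo (0 : ℝ) 1, f x * ψ x with hc
  have h' : IsWeakDeriv f 0 := h.congr (EventuallyEq.refl _ _) hg
  have key := ae_zero_of_test (f := fun x => f x - c) (hf.sub (integrable_const c))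
    (fun φ hφ => by
      set m := ∫ x in Ioo (0 : ℝ) 1, φ x with hm
      have hθ : IsTest (fun x => φ x - m * ψ x) := by
        refine ⟨hφ.smooth.sub (contDiff_const.mul hψ.smooth), ?_, ?_⟩
        · exact hφ.compact.sub (hψ.compact.mul_left)
        · refine (tsupport_sub _ _).trans (union_subset hφ.supp ?_)
          exact (tsupport_mul_subset_right).trans hψ.supp
      obtain ⟨η, hη, hηd⟩ := exists_primitive hθ (by
        rw [integral_sub hφ.integrable (hψ.integrable.const_mul m), integral_const_mul, hψ1]
        simp [hm])
      have e := h' η hη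
      rw [hηd] at e
      simp only [Pi.zero_apply, zero_mul, integral_zero, neg_zero, mul_sub] at e
      have i2 : Integrable (fun x => f x * (m * ψ x)) mu := by
        have := (hψ.integrable_mul hf).const_mul m
        refine this.congr (ae_of_all _ fun x => ?_)
        simp only; ring
      rw [integral_sub (hφ.integrable_mul hf) i2] at e
      have e3 : ∫ x in Ioo (0 : ℝ) 1, f x * (m * ψ x) = m * c := by
        rw [hc, ← integral_const_mul]
        congr 1; ext x; ring
      simp only [sub_mul]
      rw [integral_sub (hφ.integrable_mul hf) (hφ.integrable.const_mul c), integral_const_mul, ← hm]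
      linarith)
  filter_upwards [key] with x hx
  simpa [sub_eq_zero] using hx

theorem isWeakDeriv_id : IsWeakDeriv (fun x => x) (fun _ => 1) := by
  intro φ hφ
  have hd : ∀ x, HasDerivAt φ (deriv φ x) x := fun x =>
    (hφ.smooth.differentiable (by simp)).differentiableAt.hasDerivAt
  have hc' : Continuous (_root_.deriv φ) := hφ.deriv.smooth.continuous
  have h0 : φ 0 = 0 := image_eq_zero_of_notMem_tsupport (fun h => lt_irrefl _ (hφ.supp h).1)
  have h1 : φ 1 = 0 := image_eq_zero_of_notMem_tsupport (fun h => lt_irrefl _ (hφ.supp h).2)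
  rw [← integral_Ioc_eq_integral_Ioo, ← integral_Ioc_eq_integral_Ioo,
    ← intervalIntegral.integral_of_le zero_le_one, ← intervalIntegral.integral_of_le zero_le_one,
    intervalIntegral.integral_mul_deriv_eq_deriv_mul (u := fun x => x) (u' := fun _ => 1)
      (fun x _ => hasDerivAt_id x) (fun x _ => hd x) (by simp) (hc'.intervalIntegrable _ _)]
  simp [h0, h1]

/-! ### The space `X` -/

/-- The exponent `1 + 1/q`, that is, `(q+1)/q`. -/
def expo (q : ℝ) : ℝ≥0∞ := 1 + ENNReal.ofReal (1 / q)

theorem expo_eq {q : ℝ} (hq : 0 < q) : expo q = ENNReal.ofReal ((q + 1) / q) := by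
  have : (q + 1) / q = 1 + 1 / q := by field_simp
  rw [expo, this, ENNReal.ofReal_add zero_le_one (by positivity), ENNReal.ofReal_one]

instance (q : ℝ) : Fact (1 ≤ expo q) := ⟨le_self_add⟩

theorem integrable_Lp {q : ℝ} (g : Lp ℝ (expo q) mu) : Integrable g mu :=
  (Lp.memLp g).integrable (Fact.out : 1 ≤ expo q)

theorem continuous_ext (v : C(unitInterval, ℝ)) : Continuous (ext v) :=
  v.continuous.Icc_extend'

theorem ext_coe (v : C(unitInterval, ℝ)) (x : unitInterval) : ext v x = v x :=
  IccExtend_val _ _ _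

theorem integrable_ext (v : C(unitInterval, ℝ)) : Integrable (ext v) mu :=
  ((continuous_ext v).integrableOn_Icc (a := 0) (b := 1)).mono_set Ioo_subset_Icc_self

/-- `h` is the second weak derivative of `v`, the first one being in `L^{(q+1)/q}(0,1)`, too. -/
def IsSecondDeriv (q : ℝ) (v : C(unitInterval, ℝ)) (h : Lp ℝ (expo q) mu) : Prop :=
  ∃ g : Lp ℝ (expo q) mu, IsWeakDeriv (ext v) g ∧ IsWeakDeriv g h

theorem IsSecondDeriv.unique {q : ℝ} {v : C(unitInterval, ℝ)} {h h' : Lp ℝ (expo q) mu}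
    (H : IsSecondDeriv q v h) (H' : IsSecondDeriv q v h') : h = h' := by
  obtain ⟨g, h1, h2⟩ := H
  obtain ⟨g', h1', h2'⟩ := H'
  have e : g = g' := Lp.ext (h1.unique (integrable_Lp g) (integrable_Lp g') h1')
  subst e
  exact Lp.ext (h2.unique (integrable_Lp h) (integrable_Lp h') h2')

theorem IsSecondDeriv.add {q : ℝ} {v w : C(unitInterval, ℝ)} {h k : Lp ℝ (expo q) mu}
    (H : IsSecondDeriv q v h) (K : IsSecondDeriv q w k) : IsSecondDeriv q (v + w) (h + k) := by
  obtain ⟨g, h1, h2⟩ := H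
  obtain ⟨g', h1', h2'⟩ := K
  refine ⟨g + g', ?_, ?_⟩
  · exact (h1.add (integrable_ext v) (integrable_ext w) (integrable_Lp g)
      (integrable_Lp g') h1').congr (EventuallyEq.refl _ _) (Lp.coeFn_add g g').symm
  · exact (h2.add (integrable_Lp g) (integrable_Lp g') (integrable_Lp h)
      (integrable_Lp k) h2').congr (Lp.coeFn_add g g').symm (Lp.coeFn_add h k).symm

theorem IsSecondDeriv.smul {q : ℝ} {v : C(unitInterval, ℝ)} {h : Lp ℝ (expo q) mu} (c : ℝ)
    (H : IsSecondDeriv q v h) : IsSecondDeriv q (c • v) (c • h) := by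
  obtain ⟨g, h1, h2⟩ := H
  exact ⟨c • g, (h1.smul c).congr (EventuallyEq.refl _ _) (Lp.coeFn_smul c g).symm,
    (h2.smul c).congr (Lp.coeFn_smul c g).symm (Lp.coeFn_smul c h).symm⟩

theorem isSecondDeriv_zero (q : ℝ) : IsSecondDeriv q 0 0 := by
  have hz : (0 : ℝ → ℝ) =ᵐ[mu] (0 : Lp ℝ (expo q) mu) := (Lp.coeFn_zero ℝ (expo q) mu).symm
  have h0 : IsWeakDeriv 0 0 := by intro φ hφ; simp
  have he : ext 0 = 0 := rfl
  exact ⟨0, by rw [he]; exact h0.congr (EventuallyEq.refl _ _) hz, h0.congr hz hz⟩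

theorem IsSecondDeriv.eq_zero {q : ℝ} {v : C(unitInterval, ℝ)} (H : IsSecondDeriv q v 0)
    (h0 : v 0 = 0) (h1 : v 1 = 0) : v = 0 := by
  obtain ⟨g, hg, hgg⟩ := H
  obtain ⟨a, ha⟩ := hgg.ae_const (integrable_Lp g) (Lp.coeFn_zero ℝ (expo q) mu)
  have hid : Integrable (fun x : ℝ => x) mu :=
    (continuous_id.integrableOn_Icc (a := (0 : ℝ)) (b := 1)).mono_set Ioo_subset_Icc_self
  have hw := hg.add (integrable_ext v) (hid.smul (-a)) (integrable_Lp g)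
    ((integrable_const (1 : ℝ)).smul (-a)) (isWeakDeriv_id.smul (-a))
  obtain ⟨b, hb⟩ := hw.ae_const ((integrable_ext v).add (hid.smul (-a))) (by
    filter_upwards [ha] with x hx
    simp [hx])
  have hb' : ext v =ᵐ[volume.restrict (Icc (0 : ℝ) 1)] fun x => a * x + b := by
    rw [← restrict_Ioo_eq_restrict_Icc]
    filter_upwards [hb] with x hx
    simp only [Pi.add_apply, Pi.smul_apply, smul_eq_mul] at hx
    linarith
  have heq : EqOn (ext v) (fun x => a * x + b) (Icc 0 1) :=
    Measure.eqOn_of_ae_eq hb' (continuous_ext v).continuousOn (by fun_prop)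
      (by rw [interior_Icc, closure_Ioo zero_ne_one])
  have e0 : b = 0 := by
    have := heq (x := 0) (by simp)
    have h2 : ext v 0 = v 0 := ext_coe v 0
    rw [h2, h0] at this
    simpa using this.symm
  have e1 : a = 0 := by
    have := heq (x := 1) (by simp)
    have h2 : ext v 1 = v 1 := ext_coe v 1
    rw [h2, h1, e0] at this
    simpa using this.symm
  ext x
  rw [← ext_coe v x, heq x.2, e0, e1]
  simp

/-- The set of functions underlying `X`, as a linear subspace of `C[0,1]`. -/
def XSub (q : ℝ) : Submodule ℝ C(unitInterval, ℝ) where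
  carrier := {v | v 0 = 0 ∧ v 1 = 0 ∧ ∃ h, IsSecondDeriv q v h}
  zero_mem' := ⟨rfl, rfl, 0, isSecondDeriv_zero q⟩
  add_mem' := by
    rintro v w ⟨h0, h1, h, H⟩ ⟨k0, k1, k, K⟩
    exact ⟨by simp [h0, k0], by simp [h1, k1], h + k, H.add K⟩
  smul_mem' := by
    rintro c v ⟨h0, h1, h, H⟩
    exact ⟨by simp [h0], by simp [h1], c • h, H.smul c⟩

/-- The space `X = W^{2,(q+1)/q}(0,1) ∩ W_0^{1,(q+1)/q}(0,1)`; each class is given by its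
continuous representative on `[0,1]`, which vanishes at `0` and at `1`. It is a type of its own, so
that it does not inherit the maximum norm of `C[0,1]`. -/
def X (q : ℝ) : Type := XSub q

instance (q : ℝ) : AddCommGroup (X q) := inferInstanceAs (AddCommGroup (XSub q))
instance (q : ℝ) : Module ℝ (X q) := inferInstanceAs (Module ℝ (XSub q))

/-- An element of `X` as a continuous function on `[0,1]`. -/
def X.toC {q : ℝ} (v : X q) : C(unitInterval, ℝ) := v.1

/-- The second weak derivative `v ↦ v''`, from `X` to `L^{(q+1)/q}(0,1)`. -/
def D2 (q : ℝ) : X q →ₗ[ℝ] Lp ℝ (expo q) mu where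
  toFun v := v.2.2.2.choose
  map_add' v w := (v + w).2.2.2.choose_spec.unique
    (v.2.2.2.choose_spec.add w.2.2.2.choose_spec)
  map_smul' c v := (c • v).2.2.2.choose_spec.unique (v.2.2.2.choose_spec.smul c)

theorem D2_spec {q : ℝ} (v : X q) : IsSecondDeriv q v.toC (D2 q v) := v.2.2.2.choose_spec

theorem D2_injective (q : ℝ) : Function.Injective (D2 q) := by
  rw [injective_iff_map_eq_zero]
  intro v hv
  have := D2_spec v
  rw [hv] at this
  exact Subtype.ext (this.eq_zero v.2.1 v.2.2.1)

/-- The norm `‖v‖_X = ‖v''‖` of `L^{(q+1)/q}(0,1)`. -/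
instance (q : ℝ) : NormedAddCommGroup (X q) :=
  NormedAddCommGroup.induced (X q) (Lp ℝ (expo q) mu) (D2 q) (D2_injective q)

instance (q : ℝ) : NormedSpace ℝ (X q) := NormedSpace.induced ℝ (X q) (Lp ℝ (expo q) mu) (D2 q)

theorem X.norm_def {q : ℝ} (v : X q) : ‖v‖ = ‖D2 q v‖ := rfl

/-! ### The system and its energy functional -/

/-- Nonnegative classical solutions `(u,v)`, with `u, v ∈ C^2(0,1) ∩ C[0,1]`, of
`-u'' = lam |v|^{r-1} v + |v|^{p-1} v`, `-v'' = |u|^{q-1} u` in `(0,1)` with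
`u(0) = u(1) = v(0) = v(1) = 0`. -/
structure IsNonnegClassicalSol (p q r lam : ℝ) (u v : C(unitInterval, ℝ)) : Prop where
  contDiff_u : ContDiffOn ℝ 2 (ext u) (Ioo 0 1)
  contDiff_v : ContDiffOn ℝ 2 (ext v) (Ioo 0 1)
  nonneg_u : ∀ x ∈ Ioo (0 : ℝ) 1, 0 ≤ ext u x
  nonneg_v : ∀ x ∈ Ioo (0 : ℝ) 1, 0 ≤ ext v x
  eq_u : ∀ x ∈ Ioo (0 : ℝ) 1, - deriv (deriv (ext u)) x
    = lam * (|ext v x| ^ (r - 1) * ext v x) + |ext v x| ^ (p - 1) * ext v x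
  eq_v : ∀ x ∈ Ioo (0 : ℝ) 1, - deriv (deriv (ext v)) x = |ext u x| ^ (q - 1) * ext u x
  u_zero : u 0 = 0
  u_one : u 1 = 0
  v_zero : v 0 = 0
  v_one : v 1 = 0

/-- The energy functional
`J(v) = q/(q+1) ∫ |v''|^{(q+1)/q} - lam/(r+1) ∫ v_+^{r+1} - 1/(p+1) ∫ v_+^{p+1}` on `X`. -/
def J (p q r lam : ℝ) (v : X q) : ℝ :=
  q / (q + 1) * (∫ x in Ioo (0 : ℝ) 1, |D2 q v x| ^ ((q + 1) / q))
    - lam / (r + 1) * (∫ x in Ioo (0 : ℝ) 1, (max (ext v.toC x) 0) ^ (r + 1))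
    - 1 / (p + 1) * (∫ x in Ioo (0 : ℝ) 1, (max (ext v.toC x) 0) ^ (p + 1))

/-- `v` is a mountain pass critical point of `F` for the pass between `0` and `e`: the sphere of
radius `T` about `0` separates `0` from `e` and carries values bounded away, from below, from
`max (F 0) (F e)`; `v` is a critical point of `F`; and `F v` is the minimax level
`inf_γ max_{0 ≤ t ≤ 1} F(γ(t))` over all continuous paths `γ` from `0` to `e`. -/
structure IsMountainPass {E : Type*} [NormedAddCommGroup E] [NormedSpace ℝ E] (F : E → ℝ)
    (T : ℝ) (e v : E) : Prop where
  sep : 0 < T ∧ T < ‖e‖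
  ridge : ∃ C : ℝ, F 0 < C ∧ F e < C ∧ ∀ w : E, ‖w‖ = T → C ≤ F w
  crit : HasFDerivAt F (0 : E →L[ℝ] ℝ) v
  level : IsGLB {m : ℝ | ∃ γ : Path (0 : E) e, IsGreatest (range fun t => F (γ t)) m} (F v)

end HamSys

end

/-!
Write `f = -v''` and `s = (q+1)/q`, so that `v` is the Green potential of `f` and
`J v = ‖v‖^s / s - lam/(r+1) ∫ v_+^{r+1} - 1/(p+1) ∫ v_+^{p+1}` with `r + 1 < s < p + 1`.

*Geometry.* As `|v| ≤ ‖v‖_X`, for suitable `T` and small `lam` both `J` and the Nehari functional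
`v ↦ DJ(v)v` are positive on the sphere of radius `T` (`exists_geometry`). Along a ray, the Nehari
functional divided by `t^s` is concave in `log t`; hence beyond the sphere it has at most one zero,
and `J` takes its maximum over the whole ray there (`fiber_le`, `Geometry.J_smul_le`).

*Minimizers.* `X` embeds compactly into `C[0,1]`, and its norm is lower semicontinuous under uniform
convergence; the latter follows from uniform convexity instead of reflexivity
(`exists_eq_of_tendsto`, `exists_subseq_tendsto`). So `J` has a minimizer `v₂` on the closed ball of
radius `T`, of negative energy since the term in `r + 1` dominates near `0`, and a minimizer `v₁` on
the Nehari set outside the ball, of positive energy.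

*Mountain pass.* No deformation argument is needed. A path from `0` to a far point `e` of the ray of
`v₁` meets the Nehari set, where `J ≥ J v₁`, and on the segment from `0` to `e` the maximum of `J`
is `J v₁` (`Geometry.isMountainPass_of_min`).

*Criticality.* Both minimizers satisfy `IsRayCritical`: in each direction `J` does not decrease from
points of the ray of `v` arbitrarily close to `v`. Convexity of the three terms of `J` turns this
into the inequality `∫ u (-w'' - f) ≤ ‖w‖^s / s - ‖v‖^s / s` for all `w`, where `u` is the Green
potential of `lam v_+^r + v_+^p`. For `-w'' = u^q` this is the equality case of Young's inequality,
so `f = u^q` almost everywhere (`IsRayCritical.neg_D2_eq`). Thus `u` and `v` are potentials of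
continuous nonnegative functions and solve the system classically; and as `f` is bounded, `J` is
Fréchet differentiable at `v` with derivative zero (`IsRayCritical.hasFDerivAt`).
-/

noncomputable section

namespace HamSys

/-! ### Green's function -/

/-- Green's function of `-d²/dx²` on `(0,1)` with zero boundary values. -/
def gK (x y : ℝ) : ℝ := min x y * (1 - max x y)

/-- The derivative of `gK` in its first variable, off the diagonal. -/
def gK' (x y : ℝ) : ℝ := (if x < y then 1 else 0) - y

/-- The solution `w` of `-w'' = f` in `(0,1)`, `w(0) = w(1) = 0`. -/
def green (f : ℝ → ℝ) (x : ℝ) : ℝ := ∫ y in Ioo (0 : ℝ) 1, gK x y * f y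

/-- The derivative of `green f`. -/
def greenDeriv (f : ℝ → ℝ) (x : ℝ) : ℝ := ∫ y in Ioo (0 : ℝ) 1, gK' x y * f y

theorem gK_comm (x y : ℝ) : gK x y = gK y x := by
  simp only [gK, min_comm, max_comm]

theorem continuous_gK : Continuous (Function.uncurry gK) := by
  unfold gK Function.uncurry
  fun_prop

theorem measurable_gK' : Measurable (Function.uncurry gK') := by
  unfold gK' Function.uncurry
  refine Measurable.sub (Measurable.ite ?_ measurable_const measurable_const) measurable_snd
  exact measurableSet_lt measurable_fst measurable_snd

theorem gK_nonneg {x y : ℝ} (hx : x ∈ Icc (0 : ℝ) 1) (hy : y ∈ Icc (0 : ℝ) 1) : 0 ≤ gK x y :=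
  mul_nonneg (le_min hx.1 hy.1) (by linarith [max_le hx.2 hy.2])

theorem abs_gK_le {x y : ℝ} (hx : x ∈ Icc (0 : ℝ) 1) (hy : y ∈ Icc (0 : ℝ) 1) :
    |gK x y| ≤ 1 := by
  rw [abs_of_nonneg (gK_nonneg hx hy)]
  exact mul_le_one₀ ((min_le_left _ _).trans hx.2) (by linarith [max_le hx.2 hy.2])
    (by linarith [hx.1.trans (le_max_left x y)])

theorem abs_gK'_le (x : ℝ) {y : ℝ} (hy : y ∈ Icc (0 : ℝ) 1) : |gK' x y| ≤ 1 := by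
  unfold gK'
  rw [abs_le]
  split_ifs <;> constructor <;> linarith [hy.1, hy.2]

theorem abs_gK_sub_le {x x' y : ℝ} (hy : y ∈ Icc (0 : ℝ) 1) :
    |gK x y - gK x' y| ≤ |x - x'| := by
  wlog h : x' ≤ x generalizing x x'
  · rw [abs_sub_comm, abs_sub_comm x]
    exact this (le_of_not_ge h)
  rw [abs_of_nonneg (sub_nonneg.2 h)]
  have hy0 := hy.1
  have hy1 := hy.2
  unfold gK
  rw [abs_le]
  rcases le_total x y with h1 | h1 <;> rcases le_total x' y with h2 | h2 <;>
    simp only [min_eq_left, min_eq_right, max_eq_left, max_eq_right, h1, h2] <;>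
    constructor <;> nlinarith

theorem Ioo_ae_mem : ∀ᵐ x ∂mu, x ∈ Ioo (0 : ℝ) 1 := ae_restrict_mem measurableSet_Ioo

theorem integral_mu_eq (f : ℝ → ℝ) : ∫ x in Ioo (0 : ℝ) 1, f x = ∫ x in (0 : ℝ)..1, f x := by
  rw [intervalIntegral.integral_of_le zero_le_one, integral_Ioc_eq_integral_Ioo]

theorem integrable_gK_mul {f : ℝ → ℝ} (hf : Integrable f mu) {x : ℝ} (hx : x ∈ Icc (0 : ℝ) 1) :
    Integrable (fun y => gK x y * f y) mu := by
  refine hf.bdd_mul (c := 1) (continuous_gK.comp (by fun_prop : Continuous fun y : ℝ => (x, y))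
    |>.aestronglyMeasurable) ?_
  filter_upwards [Ioo_ae_mem] with y hy
  exact abs_gK_le hx (Ioo_subset_Icc_self hy)

/-- Fubini's theorem for an integral operator with bounded kernel on the unit square. -/
theorem integral_kernel_mul {k : ℝ → ℝ → ℝ} (hk : Measurable (Function.uncurry k))
    (hb : ∀ x ∈ Icc (0 : ℝ) 1, ∀ y ∈ Icc (0 : ℝ) 1, |k x y| ≤ 1) {f ψ : ℝ → ℝ}
    (hf : Integrable f mu) (hψ : Integrable ψ mu) :
    ∫ x in Ioo (0 : ℝ) 1, (∫ y in Ioo (0 : ℝ) 1, k x y * f y) * ψ x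
      = ∫ y in Ioo (0 : ℝ) 1, f y * ∫ x in Ioo (0 : ℝ) 1, k x y * ψ x := by
  have hint : Integrable (Function.uncurry fun x y => k x y * (ψ x * f y)) (mu.prod mu) := by
    refine (hψ.mul_prod hf).bdd_mul (c := 1) hk.aestronglyMeasurable ?_
    rw [Measure.prod_restrict]
    filter_upwards [ae_restrict_mem (measurableSet_Ioo.prod measurableSet_Ioo)] with z hz
    exact hb _ (Ioo_subset_Icc_self hz.1) _ (Ioo_subset_Icc_self hz.2)
  have := integral_integral_swap hint
  calc _ = ∫ x in Ioo (0 : ℝ) 1, ∫ y in Ioo (0 : ℝ) 1, k x y * (ψ x * f y) := by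
        congr 1; ext x
        rw [← integral_mul_const]
        congr 1; ext y; ring
    _ = _ := this
    _ = _ := by
        congr 1; ext y
        rw [← integral_const_mul]
        congr 1; ext x; ring

/-- Green's operator is symmetric. -/
theorem integral_green_mul {f g : ℝ → ℝ} (hf : Integrable f mu) (hg : Integrable g mu) :
    ∫ x in Ioo (0 : ℝ) 1, green f x * g x = ∫ x in Ioo (0 : ℝ) 1, f x * green g x := by
  have := integral_kernel_mul continuous_gK.measurable
    (fun x hx y hy => abs_gK_le hx hy) hf hg
  simp only [green, this]
  congr 1; ext y
  congr 2; ext x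
  rw [gK_comm]

theorem green_zero (f : ℝ → ℝ) : green f 0 = 0 := by
  rw [green, setIntegral_congr_fun (g := fun _ => 0) measurableSet_Ioo]
  · simp
  · intro y hy
    simp [gK, min_eq_left hy.1.le]

theorem green_one (f : ℝ → ℝ) : green f 1 = 0 := by
  rw [green, setIntegral_congr_fun (g := fun _ => 0) measurableSet_Ioo]
  · simp
  · intro y hy
    simp [gK, max_eq_left hy.2.le]

theorem green_nonneg {f : ℝ → ℝ} (hf : ∀ x ∈ Ioo (0 : ℝ) 1, 0 ≤ f x) {x : ℝ}
    (hx : x ∈ Icc (0 : ℝ) 1) : 0 ≤ green f x :=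
  setIntegral_nonneg measurableSet_Ioo fun y hy =>
    mul_nonneg (gK_nonneg hx (Ioo_subset_Icc_self hy)) (hf y hy)

theorem green_congr {f g : ℝ → ℝ} (h : f =ᵐ[mu] g) : green f = green g := by
  ext x
  apply integral_congr_ae
  filter_upwards [h] with y hy
  rw [hy]

theorem abs_green_le {f : ℝ → ℝ} (hf : Integrable f mu) {x : ℝ} (hx : x ∈ Icc (0 : ℝ) 1) :
    |green f x| ≤ ∫ y in Ioo (0 : ℝ) 1, |f y| := by
  rw [green, ← Real.norm_eq_abs]
  refine norm_integral_le_of_norm_le hf.abs ?_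
  filter_upwards [Ioo_ae_mem] with y hy
  rw [Real.norm_eq_abs, abs_mul]
  exact mul_le_of_le_one_left (abs_nonneg _) (abs_gK_le hx (Ioo_subset_Icc_self hy))

theorem abs_green_sub_le {f : ℝ → ℝ} (hf : Integrable f mu) {x x' : ℝ} (hx : x ∈ Icc (0 : ℝ) 1)
    (hx' : x' ∈ Icc (0 : ℝ) 1) :
    |green f x - green f x'| ≤ |x - x'| * ∫ y in Ioo (0 : ℝ) 1, |f y| := by
  rw [green, green, ← integral_sub (integrable_gK_mul hf hx) (integrable_gK_mul hf hx'),
    ← integral_const_mul, ← Real.norm_eq_abs]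
  refine norm_integral_le_of_norm_le (hf.abs.const_mul _) ?_
  filter_upwards [Ioo_ae_mem] with y hy
  rw [Real.norm_eq_abs, ← sub_mul, abs_mul]
  exact mul_le_mul_of_nonneg_right (abs_gK_sub_le (Ioo_subset_Icc_self hy)) (abs_nonneg _)

theorem green_eq {f : ℝ → ℝ} (hf : Continuous f) {x : ℝ} (hx : x ∈ Icc (0 : ℝ) 1) :
    green f x = (1 - x) * (∫ y in (0 : ℝ)..x, y * f y) + x * ∫ y in x..1, (1 - y) * f y := by
  have hc : Continuous fun y => gK x y * f y := by unfold gK; fun_prop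
  rw [green, integral_mu_eq, ← intervalIntegral.integral_add_adjacent_intervals
    (hc.intervalIntegrable 0 x) (hc.intervalIntegrable x 1), ← intervalIntegral.integral_const_mul,
    ← intervalIntegral.integral_const_mul]
  congr 1
  · apply intervalIntegral.integral_congr
    intro y hy
    rw [uIcc_of_le hx.1] at hy
    simp only [gK, min_eq_right hy.2, max_eq_left hy.2]
    ring
  · apply intervalIntegral.integral_congr
    intro y hy
    rw [uIcc_of_le hx.2] at hy
    simp only [gK, min_eq_left hy.1, max_eq_right hy.1]
    ring

theorem integral_gK'_mul {f : ℝ → ℝ} (hf : Continuous f) {y : ℝ} (hy : y ∈ Icc (0 : ℝ) 1) :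
    ∫ x in Ioo (0 : ℝ) 1, gK' x y * f x
      = (∫ x in (0 : ℝ)..y, f x) - y * ∫ x in (0 : ℝ)..1, f x := by
  have hi : Integrable f mu :=
    (hf.integrableOn_Icc (a := (0 : ℝ)) (b := 1)).mono_set Ioo_subset_Icc_self
  have h1 : ∫ x in Ioo (0 : ℝ) 1, (Iio y).indicator f x = ∫ x in (0 : ℝ)..y, f x := by
    rw [setIntegral_indicator measurableSet_Iio, intervalIntegral.integral_of_le hy.1,
      integral_Ioc_eq_integral_Ioo]
    congr 2
    ext x
    simp only [mem_inter_iff, mem_Ioo, mem_Iio]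
    exact ⟨fun h => ⟨h.1.1, h.2⟩, fun h => ⟨⟨h.1, h.2.trans_le hy.2⟩, h.2⟩⟩
  rw [← h1, ← integral_mu_eq, ← integral_const_mul, ← integral_sub
    (hi.indicator measurableSet_Iio) (hi.const_mul y)]
  congr 1
  ext x
  simp only [gK', indicator, mem_Iio]
  split_ifs <;> ring

theorem IsTest.apply_zero {φ : ℝ → ℝ} (h : IsTest φ) : φ 0 = 0 :=
  image_eq_zero_of_notMem_tsupport fun hh => lt_irrefl _ (h.supp hh).1

theorem IsTest.apply_one {φ : ℝ → ℝ} (h : IsTest φ) : φ 1 = 0 :=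
  image_eq_zero_of_notMem_tsupport fun hh => lt_irrefl _ (h.supp hh).2

theorem IsTest.hasDerivAt {φ : ℝ → ℝ} (h : IsTest φ) (x : ℝ) :
    HasDerivAt φ (_root_.deriv φ x) x :=
  (h.smooth.differentiable (by simp)).differentiableAt.hasDerivAt

theorem IsTest.integral_gK_deriv {φ : ℝ → ℝ} (h : IsTest φ) {y : ℝ} (hy : y ∈ Icc (0 : ℝ) 1) :
    ∫ x in Ioo (0 : ℝ) 1, gK x y * _root_.deriv φ x = -∫ x in Ioo (0 : ℝ) 1, gK' x y * φ x := by
  have hc : Continuous φ := h.smooth.continuous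
  have hc' : Continuous (_root_.deriv φ) := h.deriv.smooth.continuous
  have e : ∫ x in Ioo (0 : ℝ) 1, gK x y * _root_.deriv φ x = green (_root_.deriv φ) y := by
    simp only [green, gK_comm y]
  rw [e, green_eq hc' hy, integral_gK'_mul hc hy,
    intervalIntegral.integral_mul_deriv_eq_deriv_mul (u := fun x => x) (u' := fun _ => 1)
      (fun x _ => hasDerivAt_id x) (fun x _ => h.hasDerivAt x) (by simp)
      (hc'.intervalIntegrable _ _),
    intervalIntegral.integral_mul_deriv_eq_deriv_mul (u := fun x => 1 - x) (u' := fun _ => -1)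
      (fun x _ => (hasDerivAt_id x).const_sub 1) (fun x _ => h.hasDerivAt x) (by simp)
      (hc'.intervalIntegrable _ _),
    ← intervalIntegral.integral_add_adjacent_intervals (hc.intervalIntegrable 0 y)
      (hc.intervalIntegrable y 1), h.apply_one]
  simp only [one_mul, neg_mul, intervalIntegral.integral_neg]
  ring

theorem IsTest.integral_gK'_deriv {φ : ℝ → ℝ} (h : IsTest φ) {y : ℝ} (hy : y ∈ Icc (0 : ℝ) 1) :
    ∫ x in Ioo (0 : ℝ) 1, gK' x y * _root_.deriv φ x = φ y := by
  have hc' : Continuous (_root_.deriv φ) := h.deriv.smooth.continuous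
  rw [integral_gK'_mul hc' hy, intervalIntegral.integral_eq_sub_of_hasDerivAt
    (fun x _ => h.hasDerivAt x) (hc'.intervalIntegrable _ _),
    intervalIntegral.integral_eq_sub_of_hasDerivAt
    (fun x _ => h.hasDerivAt x) (hc'.intervalIntegrable _ _), h.apply_zero, h.apply_one]
  ring

theorem isWeakDeriv_green {f : ℝ → ℝ} (hf : Integrable f mu) :
    IsWeakDeriv (green f) (greenDeriv f) := by
  intro φ hφ
  have h1 := integral_kernel_mul continuous_gK.measurable (fun x hx y hy => abs_gK_le hx hy) hf
    hφ.deriv.integrable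
  have h2 := integral_kernel_mul measurable_gK' (fun x _ y hy => abs_gK'_le x hy) hf hφ.integrable
  unfold green greenDeriv
  rw [h1, h2, ← integral_neg]
  refine setIntegral_congr_fun measurableSet_Ioo fun y hy => ?_
  simp only [hφ.integral_gK_deriv (Ioo_subset_Icc_self hy)]
  ring

theorem isWeakDeriv_greenDeriv {f : ℝ → ℝ} (hf : Integrable f mu) :
    IsWeakDeriv (greenDeriv f) (-f) := by
  intro φ hφ
  have h1 := integral_kernel_mul measurable_gK' (fun x _ y hy => abs_gK'_le x hy) hf
    hφ.deriv.integrable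
  unfold greenDeriv
  rw [h1, ← integral_neg]
  refine setIntegral_congr_fun measurableSet_Ioo fun y hy => ?_
  simp only [hφ.integral_gK'_deriv (Ioo_subset_Icc_self hy), Pi.neg_apply]
  ring

theorem abs_greenDeriv_le {f : ℝ → ℝ} (hf : Integrable f mu) (x : ℝ) :
    |greenDeriv f x| ≤ ∫ y in Ioo (0 : ℝ) 1, |f y| := by
  rw [greenDeriv, ← Real.norm_eq_abs]
  refine norm_integral_le_of_norm_le hf.abs ?_
  filter_upwards [Ioo_ae_mem] with y hy
  rw [Real.norm_eq_abs, abs_mul]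
  exact mul_le_of_le_one_left (abs_nonneg _) (abs_gK'_le x (Ioo_subset_Icc_self hy))

theorem aestronglyMeasurable_greenDeriv {f : ℝ → ℝ} (hf : Integrable f mu) :
    AEStronglyMeasurable (greenDeriv f) mu := by
  have : AEStronglyMeasurable (Function.uncurry fun x y => gK' x y * f y) (mu.prod mu) :=
    measurable_gK'.aestronglyMeasurable.mul hf.aestronglyMeasurable.comp_snd
  exact this.integral_prod_right'

theorem hasDerivAt_green {f : ℝ → ℝ} (hf : Continuous f) {x : ℝ} (hx : x ∈ Ioo (0 : ℝ) 1) :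
    HasDerivAt (green f)
      (-(∫ y in (0 : ℝ)..x, y * f y) + ∫ y in x..1, (1 - y) * f y) x := by
  have c1 : Continuous fun y => y * f y := by fun_prop
  have c2 : Continuous fun y => (1 - y) * f y := by fun_prop
  have d1 := intervalIntegral.integral_hasDerivAt_right (c1.intervalIntegrable 0 x)
    (c1.stronglyMeasurableAtFilter _ _) c1.continuousAt
  have d2 := intervalIntegral.integral_hasDerivAt_left (c2.intervalIntegrable x 1)
    (c2.stronglyMeasurableAtFilter _ _) c2.continuousAt
  have := (((hasDerivAt_id x).const_sub 1).mul d1).add ((hasDerivAt_id x).mul d2)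
  have h2 := this.congr_of_eventuallyEq (f₁ := green f) (by
    filter_upwards [isOpen_Ioo.mem_nhds hx] with z hz
    exact green_eq hf (Ioo_subset_Icc_self hz))
  exact h2.congr_deriv (by simp only [id]; ring)

theorem hasDerivAt_deriv_green {f : ℝ → ℝ} (hf : Continuous f) {x : ℝ} (hx : x ∈ Ioo (0 : ℝ) 1) :
    HasDerivAt (deriv (green f)) (-f x) x := by
  have c1 : Continuous fun y => y * f y := by fun_prop
  have c2 : Continuous fun y => (1 - y) * f y := by fun_prop
  have d1 := intervalIntegral.integral_hasDerivAt_right (c1.intervalIntegrable 0 x)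
    (c1.stronglyMeasurableAtFilter _ _) c1.continuousAt
  have d2 := intervalIntegral.integral_hasDerivAt_left (c2.intervalIntegrable x 1)
    (c2.stronglyMeasurableAtFilter _ _) c2.continuousAt
  have h2 := (d1.neg.add d2).congr_of_eventuallyEq (f₁ := deriv (green f)) (by
    filter_upwards [isOpen_Ioo.mem_nhds hx] with z hz
    exact (hasDerivAt_green hf hz).deriv)
  exact h2.congr_deriv (by ring)

theorem contDiffOn_green {f : ℝ → ℝ} (hf : Continuous f) : ContDiffOn ℝ 2 (green f) (Ioo 0 1) := by
  rw [show (2 : WithTop ℕ∞) = 1 + 1 by norm_num, contDiffOn_succ_iff_deriv_of_isOpen isOpen_Ioo]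
  refine ⟨fun x hx => (hasDerivAt_green hf hx).differentiableAt.differentiableWithinAt, by simp, ?_⟩
  rw [show (1 : WithTop ℕ∞) = 0 + 1 by norm_num, contDiffOn_succ_iff_deriv_of_isOpen isOpen_Ioo]
  refine ⟨fun x hx => (hasDerivAt_deriv_green hf hx).differentiableAt.differentiableWithinAt,
    by simp, ?_⟩
  rw [contDiffOn_zero]
  exact hf.neg.continuousOn.congr fun x hx => (hasDerivAt_deriv_green hf hx).deriv

/-! ### The space `X` through Green's operator -/

instance : IsProbabilityMeasure mu := ⟨by simp⟩

theorem expo_ne_zero (q : ℝ) : expo q ≠ 0 := by simp [expo]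

theorem expo_ne_top (q : ℝ) : expo q ≠ ⊤ := by simp [expo]

theorem expo_toReal {q : ℝ} (hq : 0 < q) : (expo q).toReal = (q + 1) / q := by
  rw [expo_eq hq, ENNReal.toReal_ofReal (by positivity)]

theorem integrable_abs_rpow {q : ℝ} (hq : 0 < q) (g : Lp ℝ (expo q) mu) :
    Integrable (fun x => |g x| ^ ((q + 1) / q)) mu := by
  have := (Lp.memLp g).integrable_norm_rpow (expo_ne_zero q) (expo_ne_top q)
  rwa [expo_toReal hq] at this

theorem norm_rpow_eq {q : ℝ} (hq : 0 < q) (g : Lp ℝ (expo q) mu) :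
    ‖g‖ ^ ((q + 1) / q) = ∫ x in Ioo (0 : ℝ) 1, |g x| ^ ((q + 1) / q) := by
  have hs : (0 : ℝ) < (q + 1) / q := by positivity
  have h0 : 0 ≤ ∫ x in Ioo (0 : ℝ) 1, |g x| ^ ((q + 1) / q) :=
    integral_nonneg fun x => by positivity
  rw [Lp.norm_def, (Lp.memLp g).eLpNorm_eq_integral_rpow_norm (expo_ne_zero q) (expo_ne_top q),
    expo_toReal hq, ENNReal.toReal_ofReal (Real.rpow_nonneg (by simpa using h0) _)]
  exact Real.rpow_inv_rpow h0 hs.ne'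

theorem integral_abs_le_norm {q : ℝ} (g : Lp ℝ (expo q) mu) :
    ∫ x in Ioo (0 : ℝ) 1, |g x| ≤ ‖g‖ := by
  have h1 := eLpNorm_le_eLpNorm_of_exponent_le (μ := mu) (Fact.out : 1 ≤ expo q)
    (Lp.aestronglyMeasurable g)
  have h2 : (∫ x in Ioo (0 : ℝ) 1, |g x|) = (eLpNorm g 1 mu).toReal := by
    have := integral_norm_eq_lintegral_enorm (Lp.aestronglyMeasurable g)
    rw [eLpNorm_one_eq_lintegral_enorm]
    exact this
  rw [h2, Lp.norm_def]
  exact ENNReal.toReal_mono (Lp.eLpNorm_ne_top g) h1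

theorem ext_eq_of_mem (v : C(unitInterval, ℝ)) {x : ℝ} (hx : x ∈ Icc (0 : ℝ) 1) :
    ext v x = v ⟨x, hx⟩ := IccExtend_of_mem _ _ hx

theorem abs_ext_le (v : C(unitInterval, ℝ)) (x : ℝ) : |ext v x| ≤ ‖v‖ :=
  v.norm_coe_le_norm _

/-- `green f` as an element of `C[0,1]`. -/
def greenC (f : ℝ → ℝ) (hf : Integrable f mu) : C(unitInterval, ℝ) where
  toFun x := green f x
  continuous_toFun := by
    have : LipschitzWith (Real.toNNReal (∫ y in Ioo (0 : ℝ) 1, |f y|))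
        (fun x : unitInterval => green f x) := by
      refine LipschitzWith.of_dist_le_mul fun x y => ?_
      rw [Real.coe_toNNReal _ (integral_nonneg fun _ => abs_nonneg _), mul_comm]
      exact abs_green_sub_le hf x.2 y.2
    exact this.continuous

theorem ext_greenC {f : ℝ → ℝ} (hf : Integrable f mu) {x : ℝ} (hx : x ∈ Icc (0 : ℝ) 1) :
    ext (greenC f hf) x = green f x := ext_eq_of_mem _ hx

theorem isSecondDeriv_greenC {q : ℝ} (f : Lp ℝ (expo q) mu) :
    IsSecondDeriv q (greenC f (integrable_Lp f)) (-f) := by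
  have hm : MemLp (greenDeriv f) (expo q) mu :=
    MemLp.of_bound (aestronglyMeasurable_greenDeriv (integrable_Lp f)) _
      (ae_of_all _ (abs_greenDeriv_le (integrable_Lp f)))
  refine ⟨hm.toLp, ?_, ?_⟩
  · refine (isWeakDeriv_green (integrable_Lp f)).congr ?_ hm.coeFn_toLp.symm
    filter_upwards [Ioo_ae_mem] with x hx
    rw [ext_greenC _ (Ioo_subset_Icc_self hx)]
  · exact (isWeakDeriv_greenDeriv (integrable_Lp f)).congr hm.coeFn_toLp.symm
      (Lp.coeFn_neg f).symm

/-- The element `v` of `X` with `-v'' = f`. -/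
def solve {q : ℝ} (f : Lp ℝ (expo q) mu) : X q :=
  ⟨greenC f (integrable_Lp f), green_zero _, green_one _, -f, isSecondDeriv_greenC f⟩

theorem D2_solve {q : ℝ} (f : Lp ℝ (expo q) mu) : D2 q (solve f) = -f :=
  (D2_spec (solve f)).unique (isSecondDeriv_greenC f)

theorem ext_toC_solve {q : ℝ} (f : Lp ℝ (expo q) mu) {x : ℝ} (hx : x ∈ Icc (0 : ℝ) 1) :
    ext (solve f).toC x = green f x := ext_greenC (integrable_Lp f) hx

theorem solve_neg_D2 {q : ℝ} (v : X q) : solve (-D2 q v) = v :=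
  D2_injective q (by rw [D2_solve, neg_neg])

/-- Every element of `X` is represented by Green's function. -/
theorem ext_toC_eq_green {q : ℝ} (v : X q) {x : ℝ} (hx : x ∈ Icc (0 : ℝ) 1) :
    ext v.toC x = green (-D2 q v : Lp ℝ (expo q) mu) x := by
  conv_lhs => rw [← solve_neg_D2 v]
  exact ext_toC_solve _ hx

theorem norm_toC_le {q : ℝ} (v : X q) : ‖v.toC‖ ≤ ‖v‖ := by
  rw [ContinuousMap.norm_le _ (norm_nonneg _)]
  intro x
  rw [← ext_coe, ext_toC_eq_green v x.2, Real.norm_eq_abs, X.norm_def, ← norm_neg]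
  exact (abs_green_le (integrable_Lp _) x.2).trans (integral_abs_le_norm _)

theorem dist_toC_le {q : ℝ} (v : X q) (x y : unitInterval) :
    dist (v.toC x) (v.toC y) ≤ ‖v‖ * dist x y := by
  rw [← ext_coe, ← ext_coe, ext_toC_eq_green v x.2, ext_toC_eq_green v y.2, X.norm_def, ← norm_neg,
    mul_comm]
  exact (abs_green_sub_le (integrable_Lp _) x.2 y.2).trans
    (mul_le_mul_of_nonneg_left (integral_abs_le_norm _) (abs_nonneg _))

/-- The embedding of `X` into `C[0,1]`. -/
def toCL (q : ℝ) : X q →L[ℝ] C(unitInterval, ℝ) :=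
  LinearMap.mkContinuous (XSub q).subtype 1 fun v => by
    rw [one_mul]
    exact norm_toC_le v

theorem toCL_apply {q : ℝ} (v : X q) : toCL q v = v.toC := rfl

theorem X.toC_injective {q : ℝ} : Function.Injective (X.toC (q := q)) := Subtype.val_injective

/-- The second derivative is an isometric isomorphism of `X` with `L^{(q+1)/q}(0,1)`. -/
def D2Equiv (q : ℝ) : X q ≃ₗᵢ[ℝ] Lp ℝ (expo q) mu where
  toLinearEquiv := LinearEquiv.ofBijective (D2 q)
    ⟨D2_injective q, fun f => ⟨solve (-f), by rw [D2_solve, neg_neg]⟩⟩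
  norm_map' _ := rfl

instance (q : ℝ) : CompleteSpace (X q) :=
  (completeSpace_congr (e := (D2Equiv q).toEquiv) (D2Equiv q).isometry.isUniformEmbedding).2
    inferInstance

/-- Bounded sequences of `X` have uniformly convergent subsequences. -/
theorem exists_subseq_tendsto_toC {q R : ℝ} {w : ℕ → X q} (hw : ∀ n, ‖w n‖ ≤ R) :
    ∃ (φ : ℕ → ℕ) (v : C(unitInterval, ℝ)), StrictMono φ ∧
      Tendsto (fun n => (w (φ n)).toC) atTop (𝓝 v) := by
  let E := BoundedContinuousFunction.mkOfCompact (α := unitInterval) (β := ℝ)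
  let A : Set (BoundedContinuousFunction unitInterval ℝ) := range fun n => E (w n).toC
  have hc : IsCompact (closure A) := by
    refine BoundedContinuousFunction.arzela_ascoli (Metric.closedBall 0 R)
      (isCompact_closedBall _ _) A ?_ ?_
    · rintro _ x ⟨n, rfl⟩
      rw [mem_closedBall_zero_iff]
      exact ((w n).toC.norm_coe_le_norm x).trans ((norm_toC_le _).trans (hw n))
    · refine Metric.equicontinuous_of_continuity_modulus (fun d => R * d) ?_ _ ?_
      · have : Continuous fun d : ℝ => R * d := by fun_prop
        simpa using this.tendsto 0
      · rintro x y ⟨_, n, rfl⟩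
        exact (dist_toC_le _ _ _).trans (mul_le_mul_of_nonneg_right (hw n) dist_nonneg)
  obtain ⟨v, -, φ, hφ, hv⟩ := hc.tendsto_subseq (x := fun n => E (w n).toC)
    fun n => subset_closure ⟨n, rfl⟩
  refine ⟨φ, v.toContinuousMap, hφ, ?_⟩
  rw [tendsto_iff_dist_tendsto_zero] at hv ⊢
  exact hv

/-! ### Uniform convexity and compactness -/

theorem abs_half_add_rpow_lt {s : ℝ} (hs : 1 < s) {a b : ℝ} (hab : a ≠ b) :
    2 * |(a + b) / 2| ^ s < |a| ^ s + |b| ^ s := by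
  have hs0 : 0 < s := by linarith
  by_cases h : |a| = |b|
  · have hb : a = -b := (abs_eq_abs.1 h).resolve_left hab
    have hb0 : b ≠ 0 := by
      rintro rfl
      simp [hb] at hab
    have : (0 : ℝ) < |b| ^ s := Real.rpow_pos_of_pos (abs_pos.2 hb0) _
    rw [h, hb, neg_add_cancel, zero_div, abs_zero, Real.zero_rpow hs0.ne']
    linarith
  · have h1 := (strictConvexOn_rpow hs).2 (abs_nonneg a) (abs_nonneg b) h
      (by norm_num : (0 : ℝ) < 1 / 2) (by norm_num : (0 : ℝ) < 1 / 2) (by norm_num)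
    simp only [smul_eq_mul] at h1
    have h2 : |(a + b) / 2| ≤ 1 / 2 * |a| + 1 / 2 * |b| := by
      rw [abs_div, abs_two]
      linarith [abs_add_le a b]
    have h3 := Real.rpow_le_rpow (abs_nonneg _) h2 hs0.le
    linarith

theorem abs_half_add_rpow_le {s : ℝ} (hs : 1 < s) (a b : ℝ) :
    2 * |(a + b) / 2| ^ s ≤ |a| ^ s + |b| ^ s := by
  by_cases hab : a = b
  · rw [hab, add_self_div_two, two_mul]
  · exact (abs_half_add_rpow_lt hs hab).le

/-- Quantitative strict convexity of `|x|^s`. It is homogeneous, so that compactness of the unit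
sphere of the plane gives the constant. -/
theorem exists_abs_sub_rpow_le {s ε : ℝ} (hs : 1 < s) (hε : 0 < ε) :
    ∃ C : ℝ, 0 ≤ C ∧ ∀ a b : ℝ, |a - b| ^ s ≤ ε * (|a| ^ s + |b| ^ s)
      + C * (|a| ^ s + |b| ^ s - 2 * |(a + b) / 2| ^ s) := by
  have hs0 : 0 < s := by linarith
  have hcont : ∀ g : ℝ × ℝ → ℝ, Continuous g → Continuous fun z => |g z| ^ s := fun g hg =>
    hg.abs.rpow_const fun _ => Or.inr hs0.le
  let h : ℝ × ℝ → ℝ := fun z => |z.1| ^ s + |z.2| ^ s - 2 * |(z.1 + z.2) / 2| ^ s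
  have hh : Continuous h :=
    ((hcont _ continuous_fst).add (hcont _ continuous_snd)).sub
      ((hcont (fun z => (z.1 + z.2) / 2) (by fun_prop)).const_mul 2)
  have hK : IsCompact (Metric.sphere (0 : ℝ × ℝ) 1 ∩ {z | ε ≤ |z.1 - z.2| ^ s}) :=
    (isCompact_sphere _ _).inter_right
      (isClosed_le continuous_const (hcont (fun z => z.1 - z.2) (by fun_prop)))
  obtain ⟨c, hc, hcK⟩ := hK.exists_forall_le' (a := 0) hh.continuousOn (by
    rintro ⟨a, b⟩ ⟨-, hz⟩
    have hab : a ≠ b := by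
      rintro rfl
      simp only [mem_ofPred_eq, sub_self, abs_zero, Real.zero_rpow hs0.ne'] at hz
      linarith
    have := abs_half_add_rpow_lt hs hab
    simp only [h]
    linarith)
  have hsph : ∀ a b : ℝ, max |a| |b| = 1 → |a - b| ^ s ≤ ε * (|a| ^ s + |b| ^ s)
      + 2 ^ s / c * (|a| ^ s + |b| ^ s - 2 * |(a + b) / 2| ^ s) := by
    intro a b hab
    have hpa : 0 ≤ |a| ^ s := by positivity
    have hpb : 0 ≤ |b| ^ s := by positivity
    have hnn : 0 ≤ |a| ^ s + |b| ^ s - 2 * |(a + b) / 2| ^ s := by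
      linarith [abs_half_add_rpow_le hs a b]
    have hC : 0 ≤ (2 : ℝ) ^ s / c := by positivity
    have h1 : 1 ≤ |a| ^ s + |b| ^ s := by
      rcases max_choice |a| |b| with hm | hm <;> rw [hm] at hab <;> rw [hab, Real.one_rpow] <;>
        linarith
    by_cases hd : ε ≤ |a - b| ^ s
    · have h2 := hcK (a, b) ⟨by simpa [Prod.norm_def] using hab, hd⟩
      have h3 : |a - b| ^ s ≤ 2 ^ s := by
        refine Real.rpow_le_rpow (abs_nonneg _) ?_ hs0.le
        linarith [abs_sub a b, le_max_left |a| |b|, le_max_right |a| |b|]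
      have h4 : 2 ^ s / c * c ≤ 2 ^ s / c * (|a| ^ s + |b| ^ s - 2 * |(a + b) / 2| ^ s) :=
        mul_le_mul_of_nonneg_left h2 hC
      rw [div_mul_cancel₀ _ hc.ne'] at h4
      have h5 : 0 ≤ ε * (|a| ^ s + |b| ^ s) := by positivity
      linarith
    · have h5 := mul_le_mul_of_nonneg_left h1 hε.le
      have h6 := mul_nonneg hC hnn
      linarith
  refine ⟨2 ^ s / c, by positivity, fun a b => ?_⟩
  -- homogeneity reduces the general case to `max |a| |b| = 1`
  rcases (abs_nonneg a |>.trans (le_max_left |a| |b|)).eq_or_lt' with hm | hm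
  · have ha : a = 0 := abs_eq_zero.1 (le_antisymm (hm ▸ le_max_left _ _) (abs_nonneg _))
    have hb : b = 0 := abs_eq_zero.1 (le_antisymm (hm ▸ le_max_right _ _) (abs_nonneg _))
    simp [ha, hb, Real.zero_rpow hs0.ne']
  · set m := max |a| |b| with hmdef
    have key := hsph (a / m) (b / m) (by
      rw [abs_div, abs_div, abs_of_pos hm, max_div_div_right hm.le, ← hmdef, div_self hm.ne'])
    have e : ∀ x : ℝ, |x / m| ^ s = |x| ^ s / m ^ s := fun x => by
      rw [abs_div, abs_of_pos hm, Real.div_rpow (abs_nonneg _) hm.le]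
    have hms : 0 < m ^ s := Real.rpow_pos_of_pos hm _
    rw [← sub_div, ← add_div, div_right_comm, e, e, e, e] at key
    have := mul_le_mul_of_nonneg_right key hms.le
    field_simp at this ⊢
    linarith

/-- `X` is uniformly convex. -/
theorem exists_norm_sub_rpow_le {q ε : ℝ} (hq : 0 < q) (hε : 0 < ε) :
    ∃ C : ℝ, 0 ≤ C ∧ ∀ v w : X q, ‖v - w‖ ^ ((q + 1) / q)
      ≤ ε * (‖v‖ ^ ((q + 1) / q) + ‖w‖ ^ ((q + 1) / q))
      + C * (‖v‖ ^ ((q + 1) / q) + ‖w‖ ^ ((q + 1) / q)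
        - 2 * ‖(1 / 2 : ℝ) • (v + w)‖ ^ ((q + 1) / q)) := by
  have hs : 1 < (q + 1) / q := by rw [lt_div_iff₀ hq]; linarith
  obtain ⟨C, hC, h⟩ := exists_abs_sub_rpow_le hs hε
  refine ⟨C, hC, fun v w => ?_⟩
  simp only [X.norm_def, norm_rpow_eq hq]
  rw [map_sub, map_smul, map_add]
  set f := D2 q v
  set g := D2 q w
  set k := (1 / 2 : ℝ) • (f + g) with hk
  have hf := integrable_abs_rpow hq f
  have hg := integrable_abs_rpow hq g
  have hkI := integrable_abs_rpow hq k
  have hfg : Integrable (fun x => |f x| ^ ((q + 1) / q) + |g x| ^ ((q + 1) / q)) mu := hf.add hg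
  have hd : Integrable (fun x => |f x| ^ ((q + 1) / q) + |g x| ^ ((q + 1) / q)
    - 2 * |k x| ^ ((q + 1) / q)) mu := hfg.sub (hkI.const_mul 2)
  rw [← integral_add hf hg, ← integral_const_mul 2, ← integral_sub hfg (hkI.const_mul 2),
    ← integral_const_mul, ← integral_const_mul,
    ← integral_add (hfg.const_mul ε) (hd.const_mul C)]
  refine integral_mono_ae (integrable_abs_rpow hq (f - g))
    ((hfg.const_mul ε).add (hd.const_mul C)) ?_
  filter_upwards [Lp.coeFn_sub f g, Lp.coeFn_smul (1 / 2 : ℝ) (f + g), Lp.coeFn_add f g]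
    with x h1 h2 h3
  have h4 : k x = (f x + g x) / 2 := by
    rw [hk, h2, Pi.smul_apply, h3, Pi.add_apply, smul_eq_mul]; ring
  simp only [h1, h4, Pi.sub_apply]
  exact h (f x) (g x)

/-- In a uniformly convex Banach space a limit of `K (w n)` is `K w` for some `w` whose norm is at
most the limit of the norms: `w` is the limit of vectors of almost minimal norm in the convex sets
`{x | ‖K x - v‖ ≤ 1/(n+1)}`. This replaces weak compactness of balls. -/
theorem exists_eq_of_tendsto {E F : Type*} [NormedAddCommGroup E] [NormedSpace ℝ E]
    [CompleteSpace E] [NormedAddCommGroup F] [NormedSpace ℝ F] (K : E →L[ℝ] F) {s : ℝ} (hs : 0 < s)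
    (huc : ∀ ε : ℝ, 0 < ε → ∃ C : ℝ, 0 ≤ C ∧ ∀ v w : E, ‖v - w‖ ^ s
      ≤ ε * (‖v‖ ^ s + ‖w‖ ^ s) + C * (‖v‖ ^ s + ‖w‖ ^ s - 2 * ‖(1 / 2 : ℝ) • (v + w)‖ ^ s))
    {w : ℕ → E} {v : F} {L : ℝ} (hv : Tendsto (fun n => K (w n)) atTop (𝓝 v))
    (hL : Tendsto (fun n => ‖w n‖) atTop (𝓝 L)) :
    ∃ x : E, K x = v ∧ ‖x‖ ≤ L := by
  let S : ℕ → Set E := fun n => {x | ‖K x - v‖ ≤ 1 / ((n : ℝ) + 1)}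
  let N : ℕ → Set ℝ := fun n => (fun x : E => ‖x‖ ^ s) '' S n
  have hpos : ∀ n : ℕ, (0 : ℝ) < 1 / ((n : ℝ) + 1) := fun n => by positivity
  have hL0 : 0 ≤ L := ge_of_tendsto' hL fun n => norm_nonneg _
  have hLs : Tendsto (fun n => ‖w n‖ ^ s) atTop (𝓝 (L ^ s)) := hL.rpow_const (Or.inr hs.le)
  have hev : ∀ n, ∀ᶠ k in atTop, w k ∈ S n := fun n => by
    have := (tendsto_iff_norm_sub_tendsto_zero.1 hv).eventually_le_const (hpos n)
    exact this
  have hbdd : ∀ n, BddBelow (N n) := fun n => ⟨0, by rintro _ ⟨x, -, rfl⟩; positivity⟩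
  have hne : ∀ n, (N n).Nonempty := fun n => by
    obtain ⟨k, hk⟩ := (hev n).exists
    exact ⟨_, _, hk, rfl⟩
  let d : ℕ → ℝ := fun n => sInf (N n)
  have hdle : ∀ n x, x ∈ S n → d n ≤ ‖x‖ ^ s := fun n x hx => csInf_le (hbdd n) ⟨x, hx, rfl⟩
  have hSanti : ∀ {n m : ℕ}, n ≤ m → S m ⊆ S n := fun {n m} hnm x hx => by
    refine le_trans (show ‖K x - v‖ ≤ 1 / ((m : ℝ) + 1) from hx) ?_
    exact one_div_le_one_div_of_le (by positivity) (by exact_mod_cast Nat.succ_le_succ hnm)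
  have hdL : ∀ n, d n ≤ L ^ s := fun n =>
    ge_of_tendsto hLs ((hev n).mono fun k hk => hdle n _ hk)
  have hdmono : Monotone d := fun n m hnm =>
    csInf_le_csInf (hbdd n) (hne m) (image_mono (hSanti hnm))
  obtain ⟨D, hD⟩ : ∃ D, Tendsto d atTop (𝓝 D) :=
    ⟨_, tendsto_atTop_ciSup hdmono ⟨L ^ s, by rintro _ ⟨n, rfl⟩; exact hdL n⟩⟩
  have hDL : D ≤ L ^ s := le_of_tendsto' hD hdL
  have hdD : ∀ n, d n ≤ D := fun n => hdmono.ge_of_tendsto hD n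
  have hex : ∀ n, ∃ x ∈ S n, ‖x‖ ^ s < d n + 1 / ((n : ℝ) + 1) := fun n => by
    obtain ⟨_, ⟨x, hx, rfl⟩, hlt⟩ := exists_lt_of_csInf_lt (hne n)
      (show sInf (N n) < d n + 1 / ((n : ℝ) + 1) by have := hpos n; simp only [d]; linarith)
    exact ⟨x, hx, hlt⟩
  choose x hxS hx using hex
  have hcau : CauchySeq x := by
    rw [Metric.cauchySeq_iff']
    intro η hη
    have hηs : 0 < η ^ s := Real.rpow_pos_of_pos hη s
    have hLs0 : 0 ≤ L ^ s := Real.rpow_nonneg hL0 s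
    obtain ⟨C, hC, hCuc⟩ := huc (η ^ s / (4 * (L ^ s + 1))) (by positivity)
    have hlim : Tendsto (fun n : ℕ => C * (D - d n + 2 * (1 / ((n : ℝ) + 1)))) atTop (𝓝 0) := by
      have := ((hD.const_sub D).add
        (tendsto_one_div_add_atTop_nhds_zero_nat.const_mul (2 : ℝ))).const_mul C
      simpa using this
    obtain ⟨n, hn⟩ := (hlim.eventually_lt_const (half_pos hηs)).exists
    refine ⟨n, fun m hm => ?_⟩
    have hmid : (1 / 2 : ℝ) • (x m + x n) ∈ S n := by
      have h1 : ‖K (x m) - v‖ ≤ 1 / ((n : ℝ) + 1) := hSanti hm (hxS m)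
      have h2 : ‖K (x n) - v‖ ≤ 1 / ((n : ℝ) + 1) := hxS n
      have e : K ((1 / 2 : ℝ) • (x m + x n)) - v
          = (1 / 2 : ℝ) • ((K (x m) - v) + (K (x n) - v)) := by
        rw [map_smul, map_add]; module
      show ‖K ((1 / 2 : ℝ) • (x m + x n)) - v‖ ≤ 1 / ((n : ℝ) + 1)
      rw [e, norm_smul]
      have := norm_add_le (K (x m) - v) (K (x n) - v)
      norm_num at this ⊢
      norm_num at h1 h2
      linarith
    have h1 := hdle n _ hmid
    have h2 := hx m
    have h3 := hx n
    have h4 : 1 / ((m : ℝ) + 1) ≤ 1 / ((n : ℝ) + 1) :=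
      one_div_le_one_div_of_le (by positivity) (by exact_mod_cast Nat.succ_le_succ hm)
    have h5 : 1 / ((n : ℝ) + 1) ≤ 1 := by
      rw [div_le_one (by positivity)]
      linarith [(Nat.cast_nonneg n : (0 : ℝ) ≤ n)]
    have hCs : C * (‖x m‖ ^ s + ‖x n‖ ^ s - 2 * ‖(1 / 2 : ℝ) • (x m + x n)‖ ^ s)
        ≤ C * (D - d n + 2 * (1 / ((n : ℝ) + 1))) :=
      mul_le_mul_of_nonneg_left (by linarith [hdD m, hdD n]) hC
    have hεs : η ^ s / (4 * (L ^ s + 1)) * (‖x m‖ ^ s + ‖x n‖ ^ s) ≤ η ^ s / 2 := by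
      have : ‖x m‖ ^ s + ‖x n‖ ^ s ≤ 2 * (L ^ s + 1) := by linarith [hdL m, hdL n]
      calc _ ≤ η ^ s / (4 * (L ^ s + 1)) * (2 * (L ^ s + 1)) := by gcongr
        _ = _ := by field_simp; norm_num
    have := hCuc (x m) (x n)
    rw [dist_eq_norm]
    refine lt_of_not_ge fun hge => ?_
    have := Real.rpow_le_rpow hη.le hge hs.le
    linarith
  obtain ⟨y, hy⟩ := cauchySeq_tendsto_of_complete hcau
  refine ⟨y, ?_, ?_⟩
  · have h1 : Tendsto (fun n => ‖K (x n) - v‖) atTop (𝓝 ‖K y - v‖) :=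
      (((K.continuous.tendsto y).comp hy).sub_const v).norm
    have h2 := squeeze_zero (fun n => norm_nonneg _) hxS tendsto_one_div_add_atTop_nhds_zero_nat
    exact sub_eq_zero.1 (norm_eq_zero.1 (tendsto_nhds_unique h1 h2))
  · have h1 : Tendsto (fun n => ‖x n‖ ^ s) atTop (𝓝 (‖y‖ ^ s)) :=
      hy.norm.rpow_const (Or.inr hs.le)
    have h2 : Tendsto (fun n : ℕ => d n + 1 / ((n : ℝ) + 1)) atTop (𝓝 (D + 0)) :=
      hD.add tendsto_one_div_add_atTop_nhds_zero_nat
    rw [add_zero] at h2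
    have h3 := (le_of_tendsto_of_tendsto' h1 h2 fun n => (hx n).le).trans hDL
    exact (Real.rpow_le_rpow_iff (norm_nonneg _) hL0 hs).1 h3

/-- A bounded sequence of `X` has a subsequence that converges uniformly to an element of `X`, along
which the norm is lower semicontinuous. -/
theorem exists_subseq_tendsto {q R : ℝ} (hq : 0 < q) {w : ℕ → X q} (hw : ∀ n, ‖w n‖ ≤ R) :
    ∃ (φ : ℕ → ℕ) (v : X q) (L : ℝ), StrictMono φ ∧
      Tendsto (fun n => (w (φ n)).toC) atTop (𝓝 v.toC) ∧
      Tendsto (fun n => ‖w (φ n)‖) atTop (𝓝 L) ∧ ‖v‖ ≤ L := by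
  obtain ⟨φ, v, hφ, hv⟩ := exists_subseq_tendsto_toC hw
  obtain ⟨L, -, ψ, hψ, hL⟩ := (isCompact_Icc (a := (0 : ℝ)) (b := R)).tendsto_subseq
    (x := fun n => ‖w (φ n)‖) fun n => ⟨norm_nonneg _, hw _⟩
  obtain ⟨x, hx, hxL⟩ := exists_eq_of_tendsto (toCL q) (s := (q + 1) / q) (by positivity)
    (fun ε hε => exists_norm_sub_rpow_le hq hε) (w := fun n => w (φ (ψ n)))
    (hv.comp hψ.tendsto_atTop) hL
  refine ⟨φ ∘ ψ, x, L, hφ.comp hψ, ?_, hL, hxL⟩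
  rw [← toCL_apply x, hx]
  exact hv.comp hψ.tendsto_atTop

/-! ### The energy and its power terms -/

/-- The integral `∫ v_+^m` over `(0,1)`. -/
def posInt (m : ℝ) (v : C(unitInterval, ℝ)) : ℝ := ∫ x in Ioo (0 : ℝ) 1, (max (ext v x) 0) ^ m

theorem J_eq {p q r lam : ℝ} (hq : 0 < q) (v : X q) :
    J p q r lam v = q / (q + 1) * ‖v‖ ^ ((q + 1) / q) - lam / (r + 1) * posInt (r + 1) v.toC
      - 1 / (p + 1) * posInt (p + 1) v.toC := by
  rw [X.norm_def, norm_rpow_eq hq]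
  rfl

theorem continuous_pos_rpow {m : ℝ} (hm : 0 ≤ m) (v : C(unitInterval, ℝ)) :
    Continuous fun x => (max (ext v x) 0) ^ m :=
  ((continuous_ext v).max continuous_const).rpow_const fun _ => Or.inr hm

theorem integrable_of_continuous {f : ℝ → ℝ} (hf : Continuous f) : Integrable f mu :=
  (hf.integrableOn_Icc (a := (0 : ℝ)) (b := 1)).mono_set Ioo_subset_Icc_self

theorem posInt_nonneg (m : ℝ) (v : C(unitInterval, ℝ)) : 0 ≤ posInt m v :=
  integral_nonneg fun _ => Real.rpow_nonneg (le_max_right _ _) _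

theorem posInt_le {m : ℝ} (hm : 0 ≤ m) (v : C(unitInterval, ℝ)) : posInt m v ≤ ‖v‖ ^ m := by
  have h : posInt m v ≤ ∫ x in Ioo (0 : ℝ) 1, ‖v‖ ^ m := by
    refine integral_mono (integrable_of_continuous (continuous_pos_rpow hm v))
      (integrable_const _) fun x => ?_
    exact Real.rpow_le_rpow (le_max_right _ _)
      (max_le ((le_abs_self _).trans (abs_ext_le v x)) (norm_nonneg _)) hm
  simpa using h

theorem posInt_toC_le {q m : ℝ} (hm : 0 ≤ m) (v : X q) : posInt m v.toC ≤ ‖v‖ ^ m :=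
  (posInt_le hm _).trans (Real.rpow_le_rpow (norm_nonneg _) (norm_toC_le v) hm)

theorem ext_smul (t : ℝ) (v : C(unitInterval, ℝ)) (x : ℝ) : ext (t • v) x = t * ext v x := rfl

theorem ext_add (v w : C(unitInterval, ℝ)) (x : ℝ) : ext (v + w) x = ext v x + ext w x := rfl

theorem pos_smul_rpow {t : ℝ} (ht : 0 ≤ t) (m y : ℝ) :
    (max (t * y) 0) ^ m = t ^ m * (max y 0) ^ m := by
  rw [← Real.mul_rpow ht (le_max_right _ _), mul_max_of_nonneg _ _ ht, mul_zero]

theorem posInt_smul {t : ℝ} (ht : 0 ≤ t) (m : ℝ) (v : C(unitInterval, ℝ)) :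
    posInt m (t • v) = t ^ m * posInt m v := by
  rw [posInt, posInt, ← integral_const_mul]
  congr 1
  ext x
  rw [ext_smul, pos_smul_rpow ht]

theorem continuous_integral_ext :
    Continuous fun v : C(unitInterval, ℝ) => ∫ x in Ioo (0 : ℝ) 1, ext v x := by
  have : LipschitzWith 1 fun v : C(unitInterval, ℝ) => ∫ x in Ioo (0 : ℝ) 1, ext v x := by
    refine LipschitzWith.of_dist_le_mul fun v w => ?_
    rw [dist_eq_norm, dist_eq_norm, ← integral_sub (integrable_ext v) (integrable_ext w)]
    have := norm_integral_le_of_norm_le_const (μ := mu) (f := fun x => ext v x - ext w x)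
      (C := ‖v - w‖) (ae_of_all _ fun x => abs_ext_le (v - w) x)
    simpa using this
  exact this.continuous

theorem continuous_posInt {m : ℝ} (hm : 0 ≤ m) : Continuous (posInt m) := by
  let g : C(ℝ, ℝ) := ⟨fun y => (max y 0) ^ m,
    (continuous_id.max continuous_const).rpow_const fun _ => Or.inr hm⟩
  exact continuous_integral_ext.comp (g.continuous_postcomp (X := unitInterval))

theorem continuous_posInt_toC {q m : ℝ} (hm : 0 ≤ m) : Continuous fun v : X q => posInt m v.toC :=
  (continuous_posInt hm).comp (toCL q).continuous

/-- The graph of `y ↦ y_+^{m+1}/(m+1)` lies above its tangents. -/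
theorem pos_rpow_tangent {m : ℝ} (hm : 0 < m) (x y : ℝ) :
    (max x 0) ^ (m + 1) + (m + 1) * ((max x 0) ^ m * (y - x)) ≤ (max y 0) ^ (m + 1) := by
  set a := max x 0
  set b := max y 0
  have ha : 0 ≤ a := le_max_right _ _
  have hb : 0 ≤ b := le_max_right _ _
  have hpq : (m + 1).HolderConjugate ((m + 1) / m) := by
    rw [Real.holderConjugate_iff]
    exact ⟨by linarith, by field_simp; ring⟩
  have h := Real.young_inequality_of_nonneg hb (Real.rpow_nonneg ha m) hpq
  rw [← Real.rpow_mul ha, mul_div_cancel₀ _ hm.ne'] at h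
  have h1 : a ^ m * (y - x) ≤ b * a ^ m - a ^ (m + 1) := by
    have hx : a ^ m * x = a ^ (m + 1) := by
      rw [Real.rpow_add_one' ha (by linarith)]
      rcases le_total x 0 with h0 | h0
      · simp [a, max_eq_right h0, Real.zero_rpow hm.ne']
      · simp [a, max_eq_left h0]
    have hy : a ^ m * y ≤ a ^ m * b :=
      mul_le_mul_of_nonneg_left (le_max_left _ _) (Real.rpow_nonneg ha m)
    linarith
  have h2 := mul_le_mul_of_nonneg_left (h1.trans (sub_le_sub_right h _))
    (by linarith : (0 : ℝ) ≤ m + 1)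
  have e : (m + 1) * (b ^ (m + 1) / (m + 1) + a ^ (m + 1) / ((m + 1) / m) - a ^ (m + 1))
      = b ^ (m + 1) - a ^ (m + 1) := by
    field_simp
    ring
  linarith

theorem posInt_tangent {m : ℝ} (hm : 0 < m) (v w : C(unitInterval, ℝ)) :
    posInt (m + 1) v + (m + 1) * (∫ x in Ioo (0 : ℝ) 1, (max (ext v x) 0) ^ m * ext w x)
      ≤ posInt (m + 1) (v + w) := by
  have i1 := integrable_of_continuous (continuous_pos_rpow (by linarith : 0 ≤ m + 1) v)
  have i2 : Integrable (fun x => (m + 1) * ((max (ext v x) 0) ^ m * ext w x)) mu :=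
    (integrable_of_continuous ((continuous_pos_rpow hm.le v).mul (continuous_ext w))).const_mul _
  rw [posInt, posInt, ← integral_const_mul, ← integral_add i1 i2]
  refine integral_mono (i1.add i2)
    (integrable_of_continuous (continuous_pos_rpow (by linarith : 0 ≤ m + 1) _)) fun x => ?_
  have := pos_rpow_tangent hm (ext v x) (ext (v + w) x)
  rwa [ext_add, add_sub_cancel_left] at this

theorem norm_rpow_convex {q ε : ℝ} (hq : 0 < q) (h0 : 0 ≤ ε) (h1 : ε ≤ 1) (v w : X q) :
    ‖v + ε • (w - v)‖ ^ ((q + 1) / q)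
      ≤ (1 - ε) * ‖v‖ ^ ((q + 1) / q) + ε * ‖w‖ ^ ((q + 1) / q) := by
  have hs : 1 ≤ (q + 1) / q := by rw [le_div_iff₀ hq]; linarith
  have e : v + ε • (w - v) = (1 - ε) • v + ε • w := by module
  have h2 : ‖v + ε • (w - v)‖ ≤ (1 - ε) * ‖v‖ + ε * ‖w‖ := by
    rw [e]
    refine (norm_add_le _ _).trans_eq ?_
    rw [norm_smul, norm_smul, Real.norm_of_nonneg h0, Real.norm_of_nonneg (by linarith)]
  refine (Real.rpow_le_rpow (norm_nonneg _) h2 (by linarith)).trans ?_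
  exact (convexOn_rpow hs).2 (norm_nonneg v) (norm_nonneg w) (by linarith) h0 (by ring)

/-- The Nehari functional `v ↦ DJ(v)v`. -/
def nehari (p q r lam : ℝ) (v : X q) : ℝ :=
  ‖v‖ ^ ((q + 1) / q) - lam * posInt (r + 1) v.toC - posInt (p + 1) v.toC

theorem continuous_nehari {p q r lam : ℝ} (hq : 0 < q) (hr : 0 < r) (hp : 0 < p) :
    Continuous (nehari p q r lam) :=
  ((continuous_norm.rpow_const fun _ => Or.inr (by positivity)).sub
    ((continuous_posInt_toC (by positivity)).const_mul _)).sub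
    (continuous_posInt_toC (by positivity))

theorem J_smul {p q r lam t : ℝ} (hq : 0 < q) (ht : 0 ≤ t) (v : X q) :
    J p q r lam (t • v) = q / (q + 1) * (t ^ ((q + 1) / q) * ‖v‖ ^ ((q + 1) / q))
      - lam / (r + 1) * (t ^ (r + 1) * posInt (r + 1) v.toC)
      - 1 / (p + 1) * (t ^ (p + 1) * posInt (p + 1) v.toC) := by
  rw [J_eq hq, norm_smul, Real.norm_of_nonneg ht, Real.mul_rpow ht (norm_nonneg _),
    show (t • v).toC = t • v.toC from rfl, posInt_smul ht, posInt_smul ht]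

theorem nehari_smul {p q r lam t : ℝ} (ht : 0 ≤ t) (v : X q) :
    nehari p q r lam (t • v) = t ^ ((q + 1) / q) * ‖v‖ ^ ((q + 1) / q)
      - lam * (t ^ (r + 1) * posInt (r + 1) v.toC) - t ^ (p + 1) * posInt (p + 1) v.toC := by
  rw [nehari, norm_smul, Real.norm_of_nonneg ht, Real.mul_rpow ht (norm_nonneg _),
    show (t • v).toC = t • v.toC from rfl, posInt_smul ht, posInt_smul ht]

/-! ### The energy along a ray -/

/-- Along a ray the energy is `t ↦ A t^s/s - B t^β/β - D t^δ/δ`. -/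
def fiber (A B D s β δ t : ℝ) : ℝ := A * t ^ s / s - B * t ^ β / β - D * t ^ δ / δ

/-- `t` times the derivative of `fiber`. -/
def fiberSlope (A B D s β δ t : ℝ) : ℝ := A * t ^ s - B * t ^ β - D * t ^ δ

section fiber

variable {A B D s β δ : ℝ}

theorem concaveOn_fiber_log (hB : 0 ≤ B) (hD : 0 ≤ D) :
    ConcaveOn ℝ univ fun u : ℝ => A - B * Real.exp ((β - s) * u) - D * Real.exp ((δ - s) * u) := by
  have hexp : ∀ c : ℝ, ConvexOn ℝ univ fun u : ℝ => Real.exp (c * u) := fun c => by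
    have := convexOn_exp.comp_linearMap (LinearMap.mul ℝ ℝ c)
    rw [preimage_univ] at this
    exact this
  exact ((concaveOn_const A convex_univ).sub ((hexp _).smul hB)).sub ((hexp _).smul hD)

theorem fiberSlope_eq {t : ℝ} (ht : 0 < t) : fiberSlope A B D s β δ t = t ^ s *
    (A - B * Real.exp ((β - s) * Real.log t) - D * Real.exp ((δ - s) * Real.log t)) := by
  have h : ∀ c, Real.exp ((c - s) * Real.log t) = t ^ c / t ^ s := fun c => by
    rw [← Real.rpow_sub ht, Real.rpow_def_of_pos ht, mul_comm]
  have := (Real.rpow_pos_of_pos ht s).ne'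
  rw [h, h, fiberSlope]
  field_simp

/-- The slope divided by `t^s` is concave in `log t`: this is weighted Jensen for it. -/
theorem fiberSlope_concave (hB : 0 ≤ B) (hD : 0 ≤ D) {x y z : ℝ} (hx : 0 < x) (hxy : x < y)
    (hyz : y < z) : ∃ a b : ℝ, 0 < a ∧ 0 < b ∧ a * fiberSlope A B D s β δ x
      + b * fiberSlope A B D s β δ z ≤ fiberSlope A B D s β δ y := by
  have hy := hx.trans hxy
  have hz := hy.trans hyz
  have l1 := Real.log_lt_log hx hxy
  have l2 := Real.log_lt_log hy hyz
  have ex := fiberSlope_eq (A := A) (B := B) (D := D) (s := s) (β := β) (δ := δ) hx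
  have ey := fiberSlope_eq (A := A) (B := B) (D := D) (s := s) (β := β) (δ := δ) hy
  have ez := fiberSlope_eq (A := A) (B := B) (D := D) (s := s) (β := β) (δ := δ) hz
  set ξ := Real.log x
  set υ := Real.log y
  set ζ := Real.log z
  have hξζ : 0 < ζ - ξ := by linarith
  have hθ : 0 ≤ (ζ - υ) / (ζ - ξ) := div_nonneg (by linarith) hξζ.le
  have hθ' : 0 ≤ (υ - ξ) / (ζ - ξ) := div_nonneg (by linarith) hξζ.le
  have h := (concaveOn_fiber_log (A := A) (s := s) (β := β) (δ := δ) hB hD).2 (mem_univ ξ)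
    (mem_univ ζ) hθ hθ' (by field_simp; ring)
  have e : ((ζ - υ) / (ζ - ξ)) • ξ + ((υ - ξ) / (ζ - ξ)) • ζ = υ := by
    simp only [smul_eq_mul]
    field_simp
    ring
  rw [e] at h
  have px := Real.rpow_pos_of_pos hx s
  have py := Real.rpow_pos_of_pos hy s
  have pz := Real.rpow_pos_of_pos hz s
  refine ⟨y ^ s * ((ζ - υ) / (ζ - ξ)) / x ^ s, y ^ s * ((υ - ξ) / (ζ - ξ)) / z ^ s,
    div_pos (mul_pos py (div_pos (by linarith) hξζ)) px,
    div_pos (mul_pos py (div_pos (by linarith) hξζ)) pz, ?_⟩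
  rw [ex, ey, ez]
  have := mul_le_mul_of_nonneg_left h py.le
  simp only [smul_eq_mul] at this
  refine le_trans (le_of_eq ?_) this
  field_simp

theorem hasDerivAt_fiber (hs : 0 < s) (hβ : 0 < β) (hδ : 0 < δ) {t : ℝ} (ht : 0 < t) :
    HasDerivAt (fiber A B D s β δ) (fiberSlope A B D s β δ t / t) t := by
  have h : ∀ c : ℝ, 0 < c → ∀ E : ℝ, HasDerivAt (fun t : ℝ => E * t ^ c / c) (E * t ^ c / t) t :=
    fun c hc E => by
      have := ((Real.hasDerivAt_rpow_const (p := c) (Or.inl ht.ne')).const_mul E).div_const c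
      refine this.congr_deriv ?_
      rw [Real.rpow_sub_one ht.ne']
      field_simp
  refine (((h s hs A).sub (h β hβ B)).sub (h δ hδ D)).congr_deriv ?_
  rw [fiberSlope]
  ring

theorem continuous_fiber (hs : 0 < s) (hβ : 0 < β) (hδ : 0 < δ) :
    Continuous (fiber A B D s β δ) := by
  have h : ∀ c : ℝ, 0 < c → ∀ E : ℝ, Continuous fun t : ℝ => E * t ^ c / c := fun c hc E =>
    ((Real.continuous_rpow_const hc.le).const_mul E).div_const c
  exact ((h s hs A).sub (h β hβ B)).sub (h δ hδ D)

theorem fiber_zero (hs : 0 < s) (hβ : 0 < β) (hδ : 0 < δ) : fiber A B D s β δ 0 = 0 := by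
  simp [fiber, Real.zero_rpow hs.ne', Real.zero_rpow hβ.ne', Real.zero_rpow hδ.ne']

theorem fiber_mono (hs : 0 < s) (hβ : 0 < β) (hδ : 0 < δ) {a b : ℝ} (ha : 0 ≤ a) (hab : a ≤ b)
    (h : ∀ t ∈ Ioo a b, 0 ≤ fiberSlope A B D s β δ t) :
    fiber A B D s β δ a ≤ fiber A B D s β δ b := by
  refine monotoneOn_of_deriv_nonneg (convex_Icc a b) (continuous_fiber hs hβ hδ).continuousOn
    (fun t ht => ?_) (fun t ht => ?_) (left_mem_Icc.2 hab) (right_mem_Icc.2 hab) hab <;>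
    rw [interior_Icc] at ht
  · exact (hasDerivAt_fiber hs hβ hδ (ha.trans_lt ht.1)).differentiableAt.differentiableWithinAt
  · rw [(hasDerivAt_fiber hs hβ hδ (ha.trans_lt ht.1)).deriv]
    exact div_nonneg (h t ht) (ha.trans ht.1.le)

theorem fiber_anti (hs : 0 < s) (hβ : 0 < β) (hδ : 0 < δ) {a b : ℝ} (ha : 0 ≤ a) (hab : a ≤ b)
    (h : ∀ t ∈ Ioo a b, fiberSlope A B D s β δ t ≤ 0) :
    fiber A B D s β δ b ≤ fiber A B D s β δ a := by
  refine antitoneOn_of_deriv_nonpos (convex_Icc a b) (continuous_fiber hs hβ hδ).continuousOn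
    (fun t ht => ?_) (fun t ht => ?_) (left_mem_Icc.2 hab) (right_mem_Icc.2 hab) hab <;>
    rw [interior_Icc] at ht
  · exact (hasDerivAt_fiber hs hβ hδ (ha.trans_lt ht.1)).differentiableAt.differentiableWithinAt
  · rw [(hasDerivAt_fiber hs hβ hδ (ha.trans_lt ht.1)).deriv]
    exact div_nonpos_of_nonpos_of_nonneg (h t ht) (ha.trans ht.1.le)

theorem fiberSlope_pos (hB : 0 ≤ B) (hD : 0 ≤ D) {t₀ t : ℝ} (ht₀ : 0 < t₀)
    (h0 : 0 < fiberSlope A B D s β δ t₀) (h1 : fiberSlope A B D s β δ 1 = 0) (h2 : t₀ ≤ t)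
    (h3 : t < 1) : 0 < fiberSlope A B D s β δ t := by
  rcases h2.eq_or_lt with rfl | h2
  · exact h0
  · obtain ⟨a, b, ha, -, h⟩ :=
      fiberSlope_concave (A := A) (s := s) (β := β) (δ := δ) hB hD ht₀ h2 h3
    rw [h1, mul_zero, add_zero] at h
    exact (mul_pos ha h0).trans_le h

theorem fiberSlope_neg (hB : 0 ≤ B) (hD : 0 ≤ D) {t₀ t : ℝ} (ht₀ : 0 < t₀) (ht₀1 : t₀ < 1)
    (h0 : 0 < fiberSlope A B D s β δ t₀) (h1 : fiberSlope A B D s β δ 1 = 0)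
    (h2 : 1 < t) : fiberSlope A B D s β δ t < 0 := by
  obtain ⟨a, b, ha, hb, h⟩ :=
    fiberSlope_concave (A := A) (s := s) (β := β) (δ := δ) hB hD ht₀ ht₀1 h2
  rw [h1] at h
  by_contra hcon
  have := mul_pos ha h0
  have := mul_nonneg hb.le (not_lt.1 hcon)
  linarith

/-- The energy along a ray is largest at a zero of the slope beyond a point where energy and slope
are positive. -/
theorem fiber_le (hs : 0 < s) (hβ : 0 < β) (hδ : 0 < δ) (hB : 0 ≤ B) (hD : 0 ≤ D) {t₀ t : ℝ}
    (ht₀ : 0 < t₀) (ht₀1 : t₀ < 1) (h0 : 0 < fiberSlope A B D s β δ t₀)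
    (hj : 0 < fiber A B D s β δ t₀) (h1 : fiberSlope A B D s β δ 1 = 0) (ht : 0 ≤ t) :
    fiber A B D s β δ t ≤ fiber A B D s β δ 1 := by
  -- before `t₀` the slope is negative and then positive, so the energy there is at most the larger
  -- of its values at `0` and `t₀`
  have hmid : ∀ τ, t₀ ≤ τ → τ < 1 → 0 < fiberSlope A B D s β δ τ := fun τ h2 h3 =>
    fiberSlope_pos hB hD ht₀ h0 h1 h2 h3
  rcases le_or_gt 1 t with h | h
  · exact fiber_anti hs hβ hδ zero_le_one h fun τ hτ =>
      (fiberSlope_neg hB hD ht₀ ht₀1 h0 h1 hτ.1).le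
  rcases le_or_gt t₀ t with h' | h'
  · exact fiber_mono hs hβ hδ ht h.le fun τ hτ => (hmid τ (h'.trans hτ.1.le) hτ.2).le
  have hj1 : fiber A B D s β δ t₀ ≤ fiber A B D s β δ 1 :=
    fiber_mono hs hβ hδ ht₀.le ht₀1.le fun τ hτ => (hmid τ hτ.1.le hτ.2).le
  rcases ht.eq_or_lt with rfl | ht'
  · rw [fiber_zero hs hβ hδ]
    linarith
  rcases le_or_gt 0 (fiberSlope A B D s β δ t) with hk | hk
  · refine (fiber_mono hs hβ hδ ht h'.le fun τ hτ => ?_).trans hj1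
    obtain ⟨a, b, ha, hb, hc⟩ :=
      fiberSlope_concave (A := A) (s := s) (β := β) (δ := δ) hB hD ht' hτ.1 hτ.2
    exact (add_nonneg (mul_nonneg ha.le hk) (mul_nonneg hb.le h0.le)).trans hc
  · have : fiber A B D s β δ t ≤ fiber A B D s β δ 0 := by
      refine fiber_anti hs hβ hδ le_rfl ht fun τ hτ => ?_
      obtain ⟨a, b, ha, hb, hc⟩ :=
        fiberSlope_concave (A := A) (s := s) (β := β) (δ := δ) hB hD hτ.1 hτ.2 h'
      by_contra hcon
      have := mul_pos ha (not_le.1 hcon)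
      have := mul_pos hb h0
      linarith
    rw [fiber_zero hs hβ hδ] at this
    linarith

end fiber

theorem J_smul_eq_fiber {p q r lam t : ℝ} (hq : 0 < q) (ht : 0 ≤ t) (v : X q) :
    J p q r lam (t • v) = fiber (‖v‖ ^ ((q + 1) / q)) (lam * posInt (r + 1) v.toC)
      (posInt (p + 1) v.toC) ((q + 1) / q) (r + 1) (p + 1) t := by
  rw [J_smul hq ht, fiber]
  field_simp

theorem nehari_smul_eq_fiberSlope {p q r lam t : ℝ} (ht : 0 ≤ t) (v : X q) :
    nehari p q r lam (t • v) = fiberSlope (‖v‖ ^ ((q + 1) / q)) (lam * posInt (r + 1) v.toC)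
      (posInt (p + 1) v.toC) ((q + 1) / q) (r + 1) (p + 1) t := by
  rw [nehari_smul ht, fiberSlope]
  ring

/-! ### The Nehari set and the two minimizers -/

theorem memLp_of_continuous {f : ℝ → ℝ} (hf : Continuous f) (P : ℝ≥0∞) : MemLp f P mu := by
  obtain ⟨C, hC⟩ := (isCompact_Icc (a := (0 : ℝ)) (b := 1)).exists_bound_of_continuousOn
    hf.continuousOn
  refine MemLp.of_bound hf.aestronglyMeasurable C ?_
  filter_upwards [Ioo_ae_mem] with x hx
  exact hC x (Ioo_subset_Icc_self hx)

/-- There is an element of `X` that is positive in `(0,1)`. -/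
theorem exists_pos (q : ℝ) : ∃ v : X q, ∀ m : ℝ, 0 ≤ m → 0 < posInt m v.toC := by
  have h1 := memLp_of_continuous (f := fun _ => 1) continuous_const (expo q)
  refine ⟨solve h1.toLp, fun m hm => ?_⟩
  have hpos : ∀ x ∈ Ioo (0 : ℝ) 1, 0 < ext (solve h1.toLp).toC x := by
    intro x hx
    have hc : Continuous fun y => gK x y * (1 : ℝ) := by unfold gK; fun_prop
    rw [ext_toC_solve _ (Ioo_subset_Icc_self hx), green_congr h1.coeFn_toLp, green, integral_mu_eq]
    refine intervalIntegral.intervalIntegral_pos_of_pos_on (hc.intervalIntegrable _ _) ?_ one_pos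
    intro y hy
    rw [mul_one]
    exact mul_pos (lt_min hx.1 hy.1) (by linarith [max_lt hx.2 hy.2])
  rw [posInt, integral_mu_eq]
  refine intervalIntegral.intervalIntegral_pos_of_pos_on
    ((continuous_pos_rpow hm _).intervalIntegrable _ _) (fun x hx => ?_) one_pos
  exact Real.rpow_pos_of_pos (lt_max_of_lt_left (hpos x hx)) _

/-- The geometry of the energy on and beyond the sphere of radius `T`: energy and Nehari functional
are positive on the sphere, and the sublinear term is small beyond it. -/
structure Geometry (p q r lam T : ℝ) : Prop where
  q_pos : 0 < q
  r_pos : 0 < r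
  r_lt : r + 1 < (q + 1) / q
  lt_p : (q + 1) / q < p + 1
  lam_pos : 0 < lam
  T_pos : 0 < T
  energy : ∀ w : X q, ‖w‖ = T → q / (q + 1) * T ^ ((q + 1) / q) / 2 ≤ J p q r lam w
  slope : ∀ w : X q, ‖w‖ = T → 0 < nehari p q r lam w
  sublinear : ∀ w : X q, T ≤ ‖w‖ →
    lam * posInt (r + 1) w.toC ≤ ‖w‖ ^ ((q + 1) / q) / 2

/-- The radius does not depend on `lam`, as long as `lam` is small. -/
theorem exists_geometry {p q r : ℝ} (hq : 0 < q) (hr : 0 < r) (hr' : r + 1 < (q + 1) / q)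
    (hp : (q + 1) / q < p + 1) :
    ∃ lam₀ T : ℝ, 0 < lam₀ ∧ 0 < T ∧ ∀ lam : ℝ, 0 < lam → lam < lam₀ → Geometry p q r lam T := by
  have hsinv : q / (q + 1) = ((q + 1) / q)⁻¹ := by rw [inv_div]
  obtain ⟨s, hs⟩ : ∃ s, s = (q + 1) / q := ⟨_, rfl⟩
  have hs1 : 1 < s := by rw [hs, lt_div_iff₀ hq]; linarith
  rw [← hs] at hr' hp hsinv
  have hs0 : 0 < s := by linarith
  have hδ : 0 < p + 1 - s := by linarith
  have hδ' : 0 < p + 1 := by linarith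
  -- this radius makes the superlinear term `T^{p+1}` equal to `T^s / (4 s)`
  set T : ℝ := (1 / (4 * s)) ^ (p + 1 - s)⁻¹ with hT
  have hT0 : 0 < T := Real.rpow_pos_of_pos (by positivity) _
  have hTp : T ^ (p + 1) = T ^ s / (4 * s) := by
    have : T ^ (p + 1 - s) = 1 / (4 * s) := Real.rpow_inv_rpow (by positivity) hδ.ne'
    rw [Real.rpow_sub hT0] at this
    have h2 := Real.rpow_pos_of_pos hT0 s
    field_simp at this ⊢
    linarith
  have hTs : 0 < T ^ s := Real.rpow_pos_of_pos hT0 s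
  refine ⟨T ^ (s - (r + 1)) / (4 * s), T, by positivity, hT0, fun lam hl hl' => ?_⟩
  -- beyond the sphere the sublinear power is at most `A / (4 s)`
  have hlow : ∀ y, T ≤ y → lam * y ^ (r + 1) ≤ y ^ s / (4 * s) := by
    intro y hy
    have hy0 := hT0.trans_le hy
    have h1 : T ^ (s - (r + 1)) ≤ y ^ (s - (r + 1)) := Real.rpow_le_rpow hT0.le hy (by linarith)
    have h2 : lam ≤ y ^ (s - (r + 1)) / (4 * s) :=
      hl'.le.trans (div_le_div_of_nonneg_right h1 (by positivity))
    refine (mul_le_mul_of_nonneg_right h2 (Real.rpow_pos_of_pos hy0 _).le).trans_eq ?_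
    rw [div_mul_eq_mul_div, ← Real.rpow_add hy0]
    congr 2
    ring
  have hbounds : ∀ w : X q, ‖w‖ = T → lam * posInt (r + 1) w.toC ≤ T ^ s / (4 * s) ∧
      posInt (p + 1) w.toC ≤ T ^ s / (4 * s) := fun w hw => by
    constructor
    · refine le_trans ?_ (hlow T le_rfl)
      rw [← hw]
      exact mul_le_mul_of_nonneg_left (posInt_toC_le (by linarith) w) hl.le
    · rw [← hTp, ← hw]
      exact posInt_toC_le (by linarith) w
  refine ⟨hq, hr, hs ▸ hr', hs ▸ hp, hl, hT0, fun w hw => ?_, fun w hw => ?_, fun w hw => ?_⟩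
  · rw [J_eq hq, ← hs, hw, hsinv]
    obtain ⟨h1, h2⟩ := hbounds w hw
    have h3 : lam / (r + 1) * posInt (r + 1) w.toC ≤ T ^ s / (4 * s) := by
      refine le_trans ?_ h1
      rw [div_mul_eq_mul_div]
      exact div_le_self (mul_nonneg hl.le (posInt_nonneg _ _)) (by linarith)
    have h4 : 1 / (p + 1) * posInt (p + 1) w.toC ≤ T ^ s / (4 * s) := by
      refine le_trans ?_ h2
      rw [div_mul_eq_mul_div, one_mul]
      exact div_le_self (posInt_nonneg _ _) (by linarith)
    have e : s⁻¹ * T ^ s - T ^ s / (4 * s) - T ^ s / (4 * s) = s⁻¹ * T ^ s / 2 := by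
      field_simp
      ring
    linarith
  · rw [nehari, ← hs, hw]
    obtain ⟨h1, h2⟩ := hbounds w hw
    have h3 : T ^ s / (4 * s) < T ^ s / 4 := div_lt_div_of_pos_left hTs (by norm_num) (by linarith)
    linarith
  · rw [← hs]
    have h1 := mul_le_mul_of_nonneg_left (posInt_toC_le (m := r + 1) (by linarith) w) hl.le
    have h2 := hlow _ hw
    have h3 : ‖w‖ ^ s / (4 * s) ≤ ‖w‖ ^ s / 2 :=
      div_le_div_of_nonneg_left (by positivity) (by norm_num) (by linarith)
    linarith

/-- The part of the Nehari set on which the energy has its maximum along rays. -/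
def NehariSet (p q r lam T : ℝ) : Set (X q) := {w | T ≤ ‖w‖ ∧ nehari p q r lam w = 0}

theorem J_zero {p q r lam : ℝ} (hq : 0 < q) (hr : 0 < r) (hp : 0 < p) :
    J p q r lam (0 : X q) = 0 := by
  have := J_smul (p := p) (r := r) (lam := lam) hq le_rfl (0 : X q)
  rw [zero_smul, Real.zero_rpow (by positivity), Real.zero_rpow (by positivity),
    Real.zero_rpow (by positivity)] at this
  simpa using this

namespace Geometry

variable {p q r lam T : ℝ} (G : Geometry p q r lam T)
include G

theorem one_lt : 1 < (q + 1) / q := by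
  rw [lt_div_iff₀ G.q_pos]
  linarith [G.q_pos]

theorem p_pos : 0 < p := by linarith [G.one_lt, G.lt_p]

theorem energy_pos : 0 < q / (q + 1) * T ^ ((q + 1) / q) / 2 := by
  have := G.q_pos
  have := Real.rpow_pos_of_pos G.T_pos ((q + 1) / q)
  positivity

theorem nehari_continuous : Continuous (nehari p q r lam) :=
  continuous_nehari G.q_pos G.r_pos G.p_pos

/-- A curve that leaves the ball of radius `T`, or the region where the Nehari functional is
nonnegative, for the region beyond both, meets the Nehari set. -/
theorem exists_mem_nehariSet {g : ℝ → X q} (hg : Continuous g) {a b : ℝ} (hab : a ≤ b)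
    (ha : ‖g a‖ ≤ T ∨ 0 ≤ nehari p q r lam (g a)) (hb : T ≤ ‖g b‖)
    (hb' : nehari p q r lam (g b) ≤ 0) : ∃ t ∈ Icc a b, g t ∈ NehariSet p q r lam T := by
  -- at a zero of the minimum the norm cannot equal `T`, by positivity on the sphere
  have hc : Continuous fun t => min (‖g t‖ - T) (-nehari p q r lam (g t)) :=
    (hg.norm.sub continuous_const).min (G.nehari_continuous.comp hg).neg
  obtain ⟨t, ht, h0⟩ := intermediate_value_Icc hab hc.continuousOn (show (0 : ℝ) ∈ Icc _ _ from
    ⟨by rw [min_le_iff]; exact ha.imp (by intro h; linarith) (by intro h; linarith),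
      le_min (by linarith) (by linarith)⟩)
  refine ⟨t, ht, ?_⟩
  simp only at h0
  have h1 : 0 ≤ ‖g t‖ - T := h0 ▸ min_le_left _ _
  have h2 : 0 ≤ -nehari p q r lam (g t) := h0 ▸ min_le_right _ _
  refine ⟨by linarith, ?_⟩
  rcases min_choice (‖g t‖ - T) (-nehari p q r lam (g t)) with h | h <;> rw [h0] at h
  · linarith [G.slope (g t) (by linarith)]
  · linarith

theorem norm_gt {w : X q} (hw : w ∈ NehariSet p q r lam T) : T < ‖w‖ :=
  lt_of_le_of_ne hw.1 fun h => (G.slope w h.symm).ne' hw.2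

theorem posInt_ge {w : X q} (hw : w ∈ NehariSet p q r lam T) :
    T ^ ((q + 1) / q) / 2 ≤ posInt (p + 1) w.toC := by
  have h1 := hw.2
  have h2 := G.sublinear w hw.1
  have h3 := Real.rpow_le_rpow G.T_pos.le hw.1 (zero_le_one.trans G.one_lt.le)
  unfold nehari at h1
  linarith

theorem norm_scaled {w : X q} (hw : w ∈ NehariSet p q r lam T) : ‖(T / ‖w‖) • w‖ = T := by
  have := G.T_pos.trans (G.norm_gt hw)
  rw [norm_smul, Real.norm_of_nonneg (div_nonneg G.T_pos.le this.le), div_mul_cancel₀ _ this.ne']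

/-- On the Nehari set the energy is the largest value along the ray. -/
theorem J_smul_le {w : X q} (hw : w ∈ NehariSet p q r lam T) {t : ℝ} (ht : 0 ≤ t) :
    J p q r lam (t • w) ≤ J p q r lam w := by
  have hn := G.T_pos.trans (G.norm_gt hw)
  have ht₀ : 0 < T / ‖w‖ := div_pos G.T_pos hn
  have h := fiber_le (A := ‖w‖ ^ ((q + 1) / q)) (B := lam * posInt (r + 1) w.toC)
    (D := posInt (p + 1) w.toC) (s := (q + 1) / q) (β := r + 1) (δ := p + 1) (t := t)
    (zero_lt_one.trans G.one_lt) (by linarith [G.r_pos]) (by linarith [G.p_pos])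
    (mul_nonneg G.lam_pos.le (posInt_nonneg _ _)) (posInt_nonneg _ _) ht₀
    ((div_lt_one hn).2 (G.norm_gt hw))
    (by
      rw [← nehari_smul_eq_fiberSlope ht₀.le]
      exact G.slope _ (G.norm_scaled hw))
    (by
      rw [← J_smul_eq_fiber G.q_pos ht₀.le]
      exact G.energy_pos.trans_le (G.energy _ (G.norm_scaled hw)))
    (by
      rw [← nehari_smul_eq_fiberSlope zero_le_one, one_smul]
      exact hw.2) ht
  rwa [← J_smul_eq_fiber G.q_pos ht, ← J_smul_eq_fiber G.q_pos zero_le_one, one_smul] at h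

theorem J_ge {w : X q} (hw : w ∈ NehariSet p q r lam T) :
    q / (q + 1) * T ^ ((q + 1) / q) / 2 ≤ J p q r lam w :=
  (G.energy _ (G.norm_scaled hw)).trans
    (G.J_smul_le hw (div_nonneg G.T_pos.le (norm_nonneg _)))

theorem nehari_smul_neg {w : X q} (hw : w ∈ NehariSet p q r lam T) {t : ℝ} (ht : 1 < t) :
    nehari p q r lam (t • w) < 0 := by
  have hn := G.T_pos.trans (G.norm_gt hw)
  have ht₀ : 0 < T / ‖w‖ := div_pos G.T_pos hn
  rw [nehari_smul_eq_fiberSlope (by linarith)]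
  refine fiberSlope_neg (mul_nonneg G.lam_pos.le (posInt_nonneg _ _)) (posInt_nonneg _ _) ht₀
    ((div_lt_one hn).2 (G.norm_gt hw)) ?_ ?_ ht
  · rw [← nehari_smul_eq_fiberSlope ht₀.le]
    exact G.slope _ (G.norm_scaled hw)
  · rw [← nehari_smul_eq_fiberSlope zero_le_one, one_smul]
    exact hw.2

theorem nehari_smul_pos {w : X q} (hw : w ∈ NehariSet p q r lam T) {t : ℝ} (ht : T / ‖w‖ ≤ t)
    (ht1 : t < 1) : 0 < nehari p q r lam (t • w) := by
  have hn := G.T_pos.trans (G.norm_gt hw)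
  have ht₀ : 0 < T / ‖w‖ := div_pos G.T_pos hn
  rw [nehari_smul_eq_fiberSlope (ht₀.le.trans ht)]
  refine fiberSlope_pos (mul_nonneg G.lam_pos.le (posInt_nonneg _ _)) (posInt_nonneg _ _) ht₀
    ?_ ?_ ht ht1
  · rw [← nehari_smul_eq_fiberSlope ht₀.le]
    exact G.slope _ (G.norm_scaled hw)
  · rw [← nehari_smul_eq_fiberSlope zero_le_one, one_smul]
    exact hw.2

theorem norm_pos_of_posInt_pos {v : X q} (hv : 0 < posInt (p + 1) v.toC) : 0 < ‖v‖ := by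
  rw [norm_pos_iff]
  rintro rfl
  have := posInt_toC_le (m := p + 1) (by linarith [G.p_pos]) (0 : X q)
  rw [norm_zero, Real.zero_rpow (by linarith [G.p_pos])] at this
  linarith

/-- Far out on a ray that meets the positive cone, energy and Nehari functional are negative. -/
theorem eventually_neg {v : X q} (hv : 0 < posInt (p + 1) v.toC) :
    ∀ᶠ t : ℝ in atTop, T < ‖t • v‖ ∧ J p q r lam (t • v) < 0 ∧ nehari p q r lam (t • v) < 0 := by
  have hq := G.q_pos
  have hr := G.r_pos
  have hp := G.p_pos
  have hl := G.lam_pos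
  have hlt := G.lt_p
  have hv0 := G.norm_pos_of_posInt_pos hv
  have h1 : Tendsto (fun t : ℝ => t * ‖v‖) atTop atTop := tendsto_id.atTop_mul_const hv0
  have h2 : Tendsto (fun t : ℝ => t ^ (p + 1 - (q + 1) / q) * posInt (p + 1) v.toC) atTop atTop :=
    (tendsto_rpow_atTop (by linarith)).atTop_mul_const hv
  filter_upwards [eventually_gt_atTop 0, h1.eventually_gt_atTop T,
    h2.eventually_gt_atTop ((p + 1) * ‖v‖ ^ ((q + 1) / q))] with t ht h3 h4
  have hts := Real.rpow_pos_of_pos ht ((q + 1) / q)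
  have hA : 0 ≤ ‖v‖ ^ ((q + 1) / q) := by positivity
  have e : t ^ (p + 1) = t ^ ((q + 1) / q) * t ^ (p + 1 - (q + 1) / q) := by
    rw [← Real.rpow_add ht, add_sub_cancel]
  have h5 := mul_lt_mul_of_pos_left h4 hts
  rw [← mul_assoc _ (t ^ (p + 1 - (q + 1) / q)), ← e] at h5
  have hB : 0 ≤ lam * (t ^ (r + 1) * posInt (r + 1) v.toC) :=
    mul_nonneg hl.le (mul_nonneg (by positivity) (posInt_nonneg _ _))
  refine ⟨by rwa [norm_smul, Real.norm_of_nonneg ht.le], ?_, ?_⟩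
  · rw [J_smul hq ht.le]
    have hB' : 0 ≤ lam / (r + 1) * (t ^ (r + 1) * posInt (r + 1) v.toC) :=
      mul_nonneg (by positivity) (mul_nonneg (by positivity) (posInt_nonneg _ _))
    have h6 : q / (q + 1) * (t ^ ((q + 1) / q) * ‖v‖ ^ ((q + 1) / q))
        ≤ t ^ ((q + 1) / q) * ‖v‖ ^ ((q + 1) / q) := by
      refine mul_le_of_le_one_left (by positivity) ?_
      rw [div_le_one (by positivity)]
      linarith
    have h7 : t ^ ((q + 1) / q) * ‖v‖ ^ ((q + 1) / q)
        < 1 / (p + 1) * (t ^ (p + 1) * posInt (p + 1) v.toC) := by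
      rw [one_div, inv_mul_eq_div, lt_div_iff₀ (by linarith)]
      linarith
    linarith
  · rw [nehari_smul ht.le]
    have h6 : t ^ ((q + 1) / q) * ‖v‖ ^ ((q + 1) / q)
        ≤ t ^ ((q + 1) / q) * ((p + 1) * ‖v‖ ^ ((q + 1) / q)) :=
      mul_le_mul_of_nonneg_left (le_mul_of_one_le_left hA (by linarith)) hts.le
    linarith

theorem exists_smul_mem {v : X q} (hv : 0 < posInt (p + 1) v.toC) :
    ∃ t : ℝ, 0 ≤ t ∧ t • v ∈ NehariSet p q r lam T := by
  obtain ⟨R, ⟨h1, -, h2⟩, hR⟩ := ((G.eventually_neg hv).and (eventually_ge_atTop 0)).exists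
  obtain ⟨t, ht, hmem⟩ := G.exists_mem_nehariSet (g := fun t : ℝ => t • v) (by fun_prop) hR
    (Or.inl (by simpa using G.T_pos.le)) h1.le h2.le
  exact ⟨t, ht.1, hmem⟩

/-- The energy is lower semicontinuous along sequences as in `exists_subseq_tendsto`. -/
theorem J_lsc {w : ℕ → X q} {v : X q} {L c : ℝ} {d : ℕ → ℝ}
    (hv : Tendsto (fun n => (w n).toC) atTop (𝓝 v.toC))
    (hL : Tendsto (fun n => ‖w n‖) atTop (𝓝 L)) (hvL : ‖v‖ ≤ L)
    (hd : Tendsto d atTop (𝓝 c)) (hJ : ∀ n, J p q r lam (w n) ≤ d n) : J p q r lam v ≤ c := by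
  have hq := G.q_pos
  have hr := G.r_pos
  have hp := G.p_pos
  have h1 := ((continuous_posInt (by linarith : 0 ≤ r + 1)).tendsto _).comp hv
  have h2 := ((continuous_posInt (by linarith : 0 ≤ p + 1)).tendsto _).comp hv
  have h3 := ((hL.rpow_const (p := (q + 1) / q) (Or.inr (by positivity))).const_mul
    (q / (q + 1))).sub (h1.const_mul (lam / (r + 1))) |>.sub (h2.const_mul (1 / (p + 1)))
  have h4 := le_of_tendsto_of_tendsto' h3 hd fun n => by
    have := hJ n
    rwa [J_eq hq] at this
  refine le_trans ?_ h4
  rw [J_eq hq]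
  have : q / (q + 1) * ‖v‖ ^ ((q + 1) / q) ≤ q / (q + 1) * L ^ ((q + 1) / q) := by gcongr
  linarith

/-- Sublevel sets of the energy on the Nehari set are bounded. -/
theorem norm_le_of_J_le (M : ℝ) :
    ∃ R : ℝ, ∀ w ∈ NehariSet p q r lam T, J p q r lam w ≤ M → ‖w‖ ≤ R := by
  have hq := G.q_pos
  have hr := G.r_pos
  have hp := G.p_pos
  have hl := G.lam_pos
  have hc : 0 < q / (q + 1) - 1 / (p + 1) := by
    have := one_div_lt_one_div_of_lt (by positivity) G.lt_p
    rw [one_div_div] at this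
    linarith
  have h1 : Tendsto (fun y : ℝ => (q / (q + 1) - 1 / (p + 1)) * y ^ ((q + 1) / q - (r + 1)))
      atTop atTop := (tendsto_rpow_atTop (by linarith [G.r_lt])).const_mul_atTop hc
  obtain ⟨R, hR⟩ := eventually_atTop.1
    ((h1.eventually_ge_atTop (lam + |M| + 1)).and (eventually_ge_atTop 1))
  refine ⟨R, fun w hw hJ => ?_⟩
  by_contra hcon
  obtain ⟨h2, h3⟩ := hR ‖w‖ (not_le.1 hcon).le
  have hn : 0 < ‖w‖ := by linarith
  have hy1 : 1 ≤ ‖w‖ ^ (r + 1) := Real.one_le_rpow h3 (by linarith)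
  have e : ‖w‖ ^ ((q + 1) / q) = ‖w‖ ^ (r + 1) * ‖w‖ ^ ((q + 1) / q - (r + 1)) := by
    rw [← Real.rpow_add hn, add_sub_cancel]
  have hJe := J_eq (p := p) (r := r) (lam := lam) hq w
  have hne := hw.2
  rw [nehari] at hne
  have hB := posInt_toC_le (m := r + 1) (by linarith) w
  have hB0 := posInt_nonneg (r + 1) w.toC
  -- subtract the Nehari identity, divided by `p + 1`, to remove the superlinear term
  have hJ2 : J p q r lam w = (q / (q + 1) - 1 / (p + 1)) * ‖w‖ ^ ((q + 1) / q)
      - (1 / (r + 1) - 1 / (p + 1)) * (lam * posInt (r + 1) w.toC) := by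
    rw [hJe, show posInt (p + 1) w.toC
      = ‖w‖ ^ ((q + 1) / q) - lam * posInt (r + 1) w.toC by linarith]
    ring
  have h4 : (1 / (r + 1) - 1 / (p + 1)) * (lam * posInt (r + 1) w.toC)
      ≤ lam * ‖w‖ ^ (r + 1) := by
    have h5 : 1 / (r + 1) - 1 / (p + 1) ≤ 1 := by
      have : 1 / (r + 1) ≤ 1 := by rw [div_le_one (by linarith)]; linarith
      have : 0 ≤ 1 / (p + 1) := by positivity
      linarith
    calc _ ≤ lam * posInt (r + 1) w.toC := mul_le_of_le_one_left (by positivity) h5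
      _ ≤ _ := mul_le_mul_of_nonneg_left hB hl.le
  have h6 := mul_le_mul_of_nonneg_left h2 (by positivity : 0 ≤ ‖w‖ ^ (r + 1))
  have h7 : ‖w‖ ^ (r + 1) * (lam + |M| + 1)
      ≤ (q / (q + 1) - 1 / (p + 1)) * ‖w‖ ^ ((q + 1) / q) := by
    rw [e]
    linarith
  have h8 : |M| + 1 ≤ ‖w‖ ^ (r + 1) * (|M| + 1) := le_mul_of_one_le_left (by positivity) hy1
  linarith [le_abs_self M]

/-- The energy attains its infimum over the Nehari set. -/
theorem exists_min_nehariSet :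
    ∃ v ∈ NehariSet p q r lam T, ∀ w ∈ NehariSet p q r lam T, J p q r lam v ≤ J p q r lam w := by
  obtain ⟨v₀, hv₀⟩ := exists_pos q
  obtain ⟨t₀, -, hne⟩ := G.exists_smul_mem (hv₀ (p + 1) (by linarith [G.p_pos]))
  have hbdd : BddBelow (J p q r lam '' NehariSet p q r lam T) :=
    ⟨_, by rintro _ ⟨w, hw, rfl⟩; exact G.J_ge hw⟩
  obtain ⟨d, -, hd, hdmem⟩ := exists_seq_tendsto_sInf (⟨_, _, hne, rfl⟩ :
    (J p q r lam '' NehariSet p q r lam T).Nonempty) hbdd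
  choose w hw hwd using hdmem
  obtain ⟨M, hM⟩ := hd.bddAbove_range
  obtain ⟨R, hR⟩ := G.norm_le_of_J_le M
  obtain ⟨φ, v, L, hφ, hv, hL, hvL⟩ := exists_subseq_tendsto G.q_pos (w := w) (R := R)
    fun n => hR _ (hw n) (by rw [hwd]; exact hM ⟨n, rfl⟩)
  have hpos : 0 < posInt (p + 1) v.toC := by
    have h1 := ((continuous_posInt (by linarith [G.p_pos] : 0 ≤ p + 1)).tendsto _).comp hv
    have h2 := ge_of_tendsto' h1 fun n => G.posInt_ge (hw (φ n))
    have h3 := Real.rpow_pos_of_pos G.T_pos ((q + 1) / q)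
    linarith
  obtain ⟨t, ht, hmem⟩ := G.exists_smul_mem hpos
  -- only `t • v` need be in the Nehari set; `J (t • w n) ≤ J (w n)` bounds its energy
  refine ⟨t • v, hmem, fun z hz => le_trans ?_ (csInf_le hbdd ⟨z, hz, rfl⟩)⟩
  refine G.J_lsc (w := fun n => t • w (φ n)) (L := t * L) (d := fun n => d (φ n))
    (hv.const_smul t) ?_ ?_ (hd.comp hφ.tendsto_atTop) fun n => ?_
  · simp only [norm_smul, Real.norm_of_nonneg ht]
    exact hL.const_mul t
  · rw [norm_smul, Real.norm_of_nonneg ht]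
    gcongr
  · rw [← hwd]
    exact G.J_smul_le (hw _) ht

/-- The energy attains its infimum over the ball of radius `T`. -/
theorem exists_min_closedBall :
    ∃ v ∈ Metric.closedBall (0 : X q) T, IsMinOn (J p q r lam) (Metric.closedBall 0 T) v := by
  have hq := G.q_pos
  have hr := G.r_pos
  have hp := G.p_pos
  have hl := G.lam_pos
  have hbdd : BddBelow (J p q r lam '' Metric.closedBall (0 : X q) T) := by
    refine ⟨-(lam / (r + 1) * T ^ (r + 1)) - 1 / (p + 1) * T ^ (p + 1), ?_⟩
    rintro _ ⟨w, hw, rfl⟩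
    rw [mem_closedBall_zero_iff] at hw
    rw [J_eq hq]
    have h1 : posInt (r + 1) w.toC ≤ T ^ (r + 1) :=
      (posInt_toC_le (by linarith) w).trans (Real.rpow_le_rpow (norm_nonneg _) hw (by linarith))
    have h2 : posInt (p + 1) w.toC ≤ T ^ (p + 1) :=
      (posInt_toC_le (by linarith) w).trans (Real.rpow_le_rpow (norm_nonneg _) hw (by linarith))
    have h3 := mul_le_mul_of_nonneg_left h1 (by positivity : 0 ≤ lam / (r + 1))
    have h4 := mul_le_mul_of_nonneg_left h2 (by positivity : 0 ≤ 1 / (p + 1))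
    have h5 : 0 ≤ q / (q + 1) * ‖w‖ ^ ((q + 1) / q) := by positivity
    linarith
  obtain ⟨d, -, hd, hdmem⟩ := exists_seq_tendsto_sInf (⟨_, 0, by simpa using G.T_pos.le, rfl⟩ :
    (J p q r lam '' Metric.closedBall (0 : X q) T).Nonempty) hbdd
  choose w hw hwd using hdmem
  have hwT : ∀ n, ‖w n‖ ≤ T := fun n => mem_closedBall_zero_iff.1 (hw n)
  obtain ⟨φ, v, L, hφ, hv, hL, hvL⟩ := exists_subseq_tendsto hq hwT
  refine ⟨v, ?_, fun z hz => ?_⟩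
  · rw [mem_closedBall_zero_iff]
    exact hvL.trans (le_of_tendsto' hL fun n => hwT _)
  · exact (G.J_lsc hv hL hvL (hd.comp hφ.tendsto_atTop) fun n => (hwd _).le).trans
      (csInf_le hbdd ⟨z, hz, rfl⟩)

/-- Near `0` the sublinear term makes the energy negative along a positive ray. -/
theorem exists_J_neg : ∃ v ∈ Metric.closedBall (0 : X q) T, J p q r lam v < 0 := by
  have hq := G.q_pos
  have hr := G.r_pos
  have hp := G.p_pos
  have hl := G.lam_pos
  obtain ⟨v, hv⟩ := exists_pos q
  have hB := hv (r + 1) (by linarith)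
  set b := lam / (r + 1) * posInt (r + 1) v.toC with hb
  have hb0 : 0 < b := by positivity
  have hc : Continuous fun t : ℝ =>
      q / (q + 1) * (t ^ ((q + 1) / q - (r + 1)) * ‖v‖ ^ ((q + 1) / q)) :=
    ((Real.continuous_rpow_const (by linarith [G.r_lt])).mul_const _).const_mul _
  have h1 : ∀ᶠ t in 𝓝[>] (0 : ℝ),
      q / (q + 1) * (t ^ ((q + 1) / q - (r + 1)) * ‖v‖ ^ ((q + 1) / q)) < b := by
    refine (hc.tendsto 0).eventually_lt_const ?_ |>.filter_mono nhdsWithin_le_nhds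
    rw [Real.zero_rpow (by linarith [G.r_lt])]
    simpa using hb0
  have h2 : ∀ᶠ t in 𝓝[>] (0 : ℝ), ‖t • v‖ < T := by
    have : Continuous fun t : ℝ => ‖t • v‖ := by fun_prop
    refine (this.tendsto 0).eventually_lt_const ?_ |>.filter_mono nhdsWithin_le_nhds
    simpa using G.T_pos
  obtain ⟨t, ⟨h1, h2⟩, ht⟩ := ((h1.and h2).and self_mem_nhdsWithin).exists
  have ht : 0 < t := ht
  refine ⟨t • v, by rw [mem_closedBall_zero_iff]; exact h2.le, ?_⟩
  rw [J_smul hq ht.le]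
  have e : t ^ ((q + 1) / q) = t ^ (r + 1) * t ^ ((q + 1) / q - (r + 1)) := by
    rw [← Real.rpow_add ht, add_sub_cancel]
  have h3 := mul_lt_mul_of_pos_left h1 (Real.rpow_pos_of_pos ht (r + 1))
  have h4 : 0 ≤ 1 / (p + 1) * (t ^ (p + 1) * posInt (p + 1) v.toC) :=
    mul_nonneg (by positivity) (mul_nonneg (by positivity) (posInt_nonneg _ _))
  rw [e]
  rw [hb] at h3
  linarith

end Geometry

/-! ### Subgradients -/

/-- A function with a continuous subgradient is uniformly differentiable on bounded sets. -/
theorem exists_abs_sub_le_of_tangent {φ ψ : ℝ → ℝ} (h : ∀ x y, φ x + ψ x * (y - x) ≤ φ y)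
    (hψ : Continuous ψ) (M : ℝ) {c : ℝ} (hc : 0 < c) :
    ∃ δ : ℝ, 0 < δ ∧ ∀ x b : ℝ, |x| ≤ M → |b| ≤ δ → φ (x + b) - φ x - ψ x * b ≤ c * |b| := by
  have hu := (isCompact_Icc (a := -(M + 1)) (b := M + 1)).uniformContinuousOn_of_continuous
    hψ.continuousOn
  rw [Metric.uniformContinuousOn_iff] at hu
  obtain ⟨δ, hδ, hδ'⟩ := hu c hc
  refine ⟨min (δ / 2) 1, by positivity, fun x b hx hb => ?_⟩
  obtain ⟨hx1, hx2⟩ := abs_le.1 hx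
  obtain ⟨hb1, hb2⟩ := abs_le.1 (hb.trans (min_le_right _ _))
  have h1 := hδ' (x + b) ⟨by linarith, by linarith⟩ x ⟨by linarith, by linarith⟩ (by
    rw [Real.dist_eq, add_sub_cancel_left]
    linarith [hb.trans (min_le_left _ _)])
  rw [Real.dist_eq] at h1
  have h2 := h (x + b) x
  have h3 : (ψ (x + b) - ψ x) * b ≤ c * |b| := by
    refine (le_abs_self _).trans ?_
    rw [abs_mul]
    gcongr
  linarith

theorem integrable_pos_rpow_mul {m : ℝ} (hm : 0 ≤ m) (v h : C(unitInterval, ℝ)) :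
    Integrable (fun x => (max (ext v x) 0) ^ m * ext h x) mu :=
  integrable_of_continuous ((continuous_pos_rpow hm v).mul (continuous_ext h))

/-- The derivative of `v ↦ ∫ v_+^{m+1}`. -/
theorem posInt_sub_isLittleO {q m : ℝ} (hm : 0 < m) (v : X q) {c : ℝ} (hc : 0 < c) :
    ∀ᶠ h : X q in 𝓝 0, |posInt (m + 1) (v + h).toC - posInt (m + 1) v.toC
      - (m + 1) * ∫ x in Ioo (0 : ℝ) 1, (max (ext v.toC x) 0) ^ m * ext h.toC x| ≤ c * ‖h‖ := by
  obtain ⟨δ, hδ, hφ⟩ := exists_abs_sub_le_of_tangent (φ := fun x => (max x 0) ^ (m + 1))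
    (ψ := fun x => (m + 1) * (max x 0) ^ m)
    (fun x y => by
      have := pos_rpow_tangent hm x y
      rwa [← mul_assoc] at this)
    (((continuous_id.max continuous_const).rpow_const fun _ => Or.inr hm.le).const_mul _)
    ‖v.toC‖ hc
  have hnhds : ∀ᶠ h : X q in 𝓝 0, ‖h‖ < δ := by
    have : Continuous fun h : X q => ‖h‖ := continuous_norm
    refine (this.tendsto 0).eventually_lt_const ?_
    simpa using hδ
  filter_upwards [hnhds] with h hh
  have e : (v + h).toC = v.toC + h.toC := rfl
  have hlow := posInt_tangent hm v.toC h.toC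
  rw [← e] at hlow
  have i0 := integrable_of_continuous (continuous_pos_rpow (by linarith : 0 ≤ m + 1) (v + h).toC)
  have i1 := integrable_of_continuous (continuous_pos_rpow (by linarith : 0 ≤ m + 1) v.toC)
  have i2 : Integrable (fun x => (m + 1) * ((max (ext v.toC x) 0) ^ m * ext h.toC x)) mu :=
    (integrable_pos_rpow_mul hm.le _ _).const_mul _
  have hup : posInt (m + 1) (v + h).toC - posInt (m + 1) v.toC
      - (m + 1) * (∫ x in Ioo (0 : ℝ) 1, (max (ext v.toC x) 0) ^ m * ext h.toC x)
      ≤ ∫ x in Ioo (0 : ℝ) 1, c * ‖h‖ := by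
    have i01 : Integrable (fun x => (max (ext (v + h).toC x) 0) ^ (m + 1)
      - (max (ext v.toC x) 0) ^ (m + 1)) mu := i0.sub i1
    rw [posInt, posInt, ← integral_const_mul, ← integral_sub i0 i1, ← integral_sub i01 i2]
    refine integral_mono (i01.sub i2) (integrable_const _) fun x => ?_
    have h1 : |ext h.toC x| ≤ ‖h‖ := (abs_ext_le _ x).trans (norm_toC_le h)
    have h2 := hφ (ext v.toC x) (ext h.toC x) (abs_ext_le _ x) (h1.trans hh.le)
    have h3 := mul_le_mul_of_nonneg_left h1 hc.le
    rw [mul_assoc] at h2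
    exact h2.trans h3
  have hup' : posInt (m + 1) (v + h).toC - posInt (m + 1) v.toC
      - (m + 1) * (∫ x in Ioo (0 : ℝ) 1, (max (ext v.toC x) 0) ^ m * ext h.toC x)
      ≤ c * ‖h‖ := by simpa using hup
  rw [abs_le]
  have : 0 ≤ c * ‖h‖ := by positivity
  constructor <;> linarith

section power

variable {q : ℝ}

theorem abs_rpow_eq_pos_add {s : ℝ} (hs : 0 < s) (x : ℝ) :
    |x| ^ s = (max x 0) ^ s + (max (-x) 0) ^ s := by
  rcases le_total 0 x with h | h
  · rw [abs_of_nonneg h, max_eq_left h, max_eq_right (by linarith), Real.zero_rpow hs.ne', add_zero]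
  · rw [abs_of_nonpos h, max_eq_right h, max_eq_left (by linarith), Real.zero_rpow hs.ne', zero_add]

/-- The derivative `|x|^{1/q-1} x` of `q/(q+1) |x|^{(q+1)/q}`. -/
def oddPow (q x : ℝ) : ℝ := (max x 0) ^ (1 / q) - (max (-x) 0) ^ (1 / q)

theorem continuous_oddPow (hq : 0 < q) : Continuous (oddPow q) :=
  ((continuous_id.max continuous_const).rpow_const fun _ => Or.inr (by positivity)).sub
    ((continuous_neg.max continuous_const).rpow_const fun _ => Or.inr (by positivity))

theorem oddPow_rpow (hq : 0 < q) {u : ℝ} (hu : 0 ≤ u) : oddPow q (u ^ q) = u := by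
  have h := Real.rpow_nonneg hu q
  rw [oddPow, max_eq_left h, max_eq_right (by linarith), Real.zero_rpow (by positivity), sub_zero,
    one_div, Real.rpow_rpow_inv hu hq.ne']

theorem abs_rpow_tangent (hq : 0 < q) (x y : ℝ) :
    q / (q + 1) * |x| ^ ((q + 1) / q) + oddPow q x * (y - x)
      ≤ q / (q + 1) * |y| ^ ((q + 1) / q) := by
  have hs : 0 < (q + 1) / q := by positivity
  have e : (q + 1) / q = 1 / q + 1 := by field_simp; ring
  have hm : 0 < 1 / q := by positivity
  have h1 := pos_rpow_tangent hm x y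
  have h2 := pos_rpow_tangent hm (-x) (-y)
  rw [abs_rpow_eq_pos_add hs, abs_rpow_eq_pos_add hs, oddPow]
  rw [← e] at h1 h2
  have h3 := mul_le_mul_of_nonneg_left (add_le_add h1 h2) (by positivity : 0 ≤ q / (q + 1))
  refine le_trans (le_of_eq ?_) h3
  field_simp
  ring

/-- Equality in Young's inequality. -/
theorem eq_rpow_of_le (hq : 0 < q) {u y : ℝ} (hu : 0 ≤ u)
    (h : q / (q + 1) * |y| ^ ((q + 1) / q) - u * y
      ≤ q / (q + 1) * |u ^ q| ^ ((q + 1) / q) - u * u ^ q) : y = u ^ q := by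
  by_contra hne
  have hs : 1 < (q + 1) / q := by rw [lt_div_iff₀ hq]; linarith
  have h1 := abs_half_add_rpow_lt hs hne
  have h2 := abs_rpow_tangent hq (u ^ q) ((y + u ^ q) / 2)
  rw [oddPow_rpow hq hu] at h2
  have h3 := mul_lt_mul_of_pos_left h1 (by positivity : 0 < q / (q + 1))
  linarith

/-- Differentiability of the leading power, with an error term that is integrable for increments
in `L^{(q+1)/q}`. -/
theorem exists_abs_rpow_sub_le (hq : 0 < q) (M : ℝ) {c : ℝ} (hc : 0 < c) :
    ∃ C : ℝ, 0 ≤ C ∧ ∀ x b : ℝ, |x| ≤ M →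
      q / (q + 1) * |x + b| ^ ((q + 1) / q) - q / (q + 1) * |x| ^ ((q + 1) / q) - oddPow q x * b
        ≤ c * |b| + C * |b| ^ ((q + 1) / q) := by
  have hs : 1 < (q + 1) / q := by rw [lt_div_iff₀ hq]; linarith
  obtain ⟨δ, hδ, hφ⟩ := exists_abs_sub_le_of_tangent
    (φ := fun x => q / (q + 1) * |x| ^ ((q + 1) / q)) (ψ := oddPow q)
    (abs_rpow_tangent hq) (continuous_oddPow hq) M hc
  obtain ⟨N, hN⟩ := (isCompact_Icc (a := -M) (b := M)).exists_bound_of_continuousOn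
    (continuous_oddPow hq).continuousOn
  obtain ⟨s, hsdef⟩ : ∃ s, s = (q + 1) / q := ⟨_, rfl⟩
  rw [← hsdef] at hs hφ ⊢
  refine ⟨(|M| / δ + 1) ^ s + |N| / δ ^ (s - 1), by positivity, fun x b hx => ?_⟩
  rcases le_or_gt |b| δ with hb | hb
  · refine (hφ x b hx hb).trans (le_add_of_nonneg_right (by positivity))
  · have hb0 : 0 < |b| := hδ.trans hb
    have hq1 : q / (q + 1) ≤ 1 := by rw [div_le_one (by positivity)]; linarith
    have hq0 : 0 < q / (q + 1) := by positivity
    have h1 : |x + b| ^ s ≤ (|M| / δ + 1) ^ s * |b| ^ s := by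
      rw [← Real.mul_rpow (by positivity) hb0.le]
      refine Real.rpow_le_rpow (abs_nonneg _) ?_ (by linarith)
      have : |M| ≤ |M| / δ * |b| := by
        rw [div_mul_eq_mul_div, le_div_iff₀ hδ]
        gcongr
      linarith [abs_add_le x b, le_abs_self M]
    have h2 : -(oddPow q x * b) ≤ |N| / δ ^ (s - 1) * |b| ^ s := by
      have h3 : |oddPow q x| ≤ |N| := (hN x (abs_le.1 hx)).trans (le_abs_self N)
      have h4 : |b| ≤ |b| ^ s / δ ^ (s - 1) := by
        rw [le_div_iff₀ (by positivity)]
        have : |b| ^ s = |b| * |b| ^ (s - 1) := by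
          rw [Real.rpow_sub_one hb0.ne']
          field_simp
        rw [this]
        exact mul_le_mul_of_nonneg_left (Real.rpow_le_rpow hδ.le hb.le (by linarith)) hb0.le
      calc -(oddPow q x * b) ≤ |oddPow q x| * |b| := by
            rw [← abs_mul]; exact neg_le_abs _
        _ ≤ |N| * (|b| ^ s / δ ^ (s - 1)) := by gcongr
        _ = _ := by ring
    have h5 : q / (q + 1) * |x + b| ^ s ≤ |x + b| ^ s := mul_le_of_le_one_left (by positivity) hq1
    have h6 : 0 ≤ q / (q + 1) * |x| ^ s := by positivity
    have h7 : 0 ≤ c * |b| := by positivity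
    linarith

end power

/-- The right-hand side `lam v_+^r + v_+^p` of the equation for `u`. -/
def rhs (p r lam : ℝ) (v : C(unitInterval, ℝ)) (x : ℝ) : ℝ :=
  lam * (max (ext v x) 0) ^ r + (max (ext v x) 0) ^ p

theorem continuous_rhs {p r : ℝ} (lam : ℝ) (hr : 0 < r) (hp : 0 < p) (v : C(unitInterval, ℝ)) :
    Continuous (rhs p r lam v) :=
  ((continuous_pos_rpow hr.le v).const_mul lam).add (continuous_pos_rpow hp.le v)

theorem integral_rhs_mul {p r : ℝ} (lam : ℝ) (hr : 0 < r) (hp : 0 < p) (v h : C(unitInterval, ℝ)) :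
    ∫ x in Ioo (0 : ℝ) 1, rhs p r lam v x * ext h x
      = lam * (∫ x in Ioo (0 : ℝ) 1, (max (ext v x) 0) ^ r * ext h x)
        + ∫ x in Ioo (0 : ℝ) 1, (max (ext v x) 0) ^ p * ext h x := by
  rw [← integral_const_mul, ← integral_add ((integrable_pos_rpow_mul hr.le v h).const_mul lam)
    (integrable_pos_rpow_mul hp.le v h)]
  congr 1
  ext x
  rw [rhs]
  ring

/-- A weak form of criticality: from points near `v` on its ray, the energy does not decrease in
any direction. -/
def IsRayCritical (p q r lam : ℝ) (v : X q) : Prop :=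
  ∀ h : X q, ∀ η : ℝ, 0 < η → ∀ᶠ ε : ℝ in 𝓝[>] 0, ∃ τ : ℝ, |τ - 1| < η ∧
    J p q r lam (τ • v) ≤ J p q r lam (τ • (v + ε • h))

/-- The negative of the gradient of the two power terms is a subgradient of the leading term. -/
theorem IsRayCritical.subgradient {p q r lam : ℝ} {v : X q} (H : IsRayCritical p q r lam v)
    (hq : 0 < q) (hr : 0 < r) (hp : 0 < p) (hl : 0 < lam) (w : X q) :
    ∫ x in Ioo (0 : ℝ) 1, rhs p r lam v.toC x * ext (w - v).toC x
      ≤ q / (q + 1) * ‖w‖ ^ ((q + 1) / q) - q / (q + 1) * ‖v‖ ^ ((q + 1) / q) := by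
  rw [integral_rhs_mul lam hr hp]
  set a := ∫ x in Ioo (0 : ℝ) 1, (max (ext v.toC x) 0) ^ r * ext (w - v).toC x with ha
  set b := ∫ x in Ioo (0 : ℝ) 1, (max (ext v.toC x) 0) ^ p * ext (w - v).toC x with hb
  set d := q / (q + 1) * ‖w‖ ^ ((q + 1) / q) - q / (q + 1) * ‖v‖ ^ ((q + 1) / q) with hd
  by_contra hcon
  have hc : Continuous fun τ : ℝ => τ ^ ((q + 1) / q) * d - (lam * (τ ^ (r + 1) * a)
      + τ ^ (p + 1) * b) :=
    ((Real.continuous_rpow_const (by positivity)).mul_const _).sub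
      ((((Real.continuous_rpow_const (by positivity)).mul_const _).const_mul _).add
        ((Real.continuous_rpow_const (by positivity)).mul_const _))
  have hneg : ∀ᶠ τ in 𝓝 (1 : ℝ), τ ^ ((q + 1) / q) * d - (lam * (τ ^ (r + 1) * a)
      + τ ^ (p + 1) * b) < 0 := by
    refine (hc.tendsto 1).eventually_lt_const ?_
    simp only [Real.one_rpow, one_mul]
    linarith
  obtain ⟨η, hη, hball⟩ := Metric.eventually_nhds_iff.1 (hneg.and (eventually_gt_nhds zero_lt_one))
  obtain ⟨ε, ⟨⟨τ, hτ, hJ⟩, hε1⟩, hε⟩ := (((H (w - v) η hη).and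
    ((eventually_lt_nhds zero_lt_one).filter_mono nhdsWithin_le_nhds)).and
    self_mem_nhdsWithin).exists
  have hε : 0 < ε := hε
  obtain ⟨h1, hτ0⟩ := hball (y := τ) (by rwa [Real.dist_eq])
  rw [J_smul hq hτ0.le, J_smul hq hτ0.le] at hJ
  have hn := norm_rpow_convex hq hε.le hε1.le v w
  have ht : ∀ m : ℝ, 0 < m → posInt (m + 1) v.toC
      + (m + 1) * (ε * ∫ x in Ioo (0 : ℝ) 1, (max (ext v.toC x) 0) ^ m * ext (w - v).toC x)
      ≤ posInt (m + 1) (v + ε • (w - v)).toC := fun m hm => by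
    have := posInt_tangent hm v.toC (ε • (w - v).toC)
    rw [← integral_const_mul]
    refine le_trans (le_of_eq ?_) this
    congr 3
    ext x
    rw [ext_smul]
    ring
  have hA := ht r hr
  have hB := ht p hp
  rw [← ha] at hA
  rw [← hb] at hB
  have k1 := mul_le_mul_of_nonneg_left hn
    (by positivity : 0 ≤ q / (q + 1) * τ ^ ((q + 1) / q))
  have k2 := mul_le_mul_of_nonneg_left hA (by positivity : 0 ≤ lam / (r + 1) * τ ^ (r + 1))
  have k3 := mul_le_mul_of_nonneg_left hB (by positivity : 0 ≤ 1 / (p + 1) * τ ^ (p + 1))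
  have k4 := mul_neg_of_pos_of_neg hε h1
  have e2 : lam / (r + 1) * τ ^ (r + 1) * ((r + 1) * (ε * a)) = ε * (lam * (τ ^ (r + 1) * a)) := by
    field_simp
  have e3 : 1 / (p + 1) * τ ^ (p + 1) * ((p + 1) * (ε * b)) = ε * (τ ^ (p + 1) * b) := by
    field_simp
  have e1 : ε * (τ ^ ((q + 1) / q) * d) = q / (q + 1) * τ ^ ((q + 1) / q) *
      (ε * ‖w‖ ^ ((q + 1) / q) - ε * ‖v‖ ^ ((q + 1) / q)) := by
    rw [hd]
    ring
  rw [mul_add] at k2 k3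
  rw [e2] at k2
  rw [e3] at k3
  rw [mul_sub, mul_add, e1] at k4
  linarith

/-! ### Critical points are classical solutions -/

theorem rhs_nonneg {p r lam : ℝ} (hl : 0 < lam) (v : C(unitInterval, ℝ)) (x : ℝ) :
    0 ≤ rhs p r lam v x := by
  have := le_max_right (ext v x) 0
  unfold rhs
  positivity

/-- The first component `u` of the solution belonging to a critical point `v`. -/
def uSol {p r : ℝ} (lam : ℝ) (hr : 0 < r) (hp : 0 < p) (v : C(unitInterval, ℝ)) :
    C(unitInterval, ℝ) :=
  greenC (rhs p r lam v) (integrable_of_continuous (continuous_rhs lam hr hp v))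

section critical

variable {p q r lam : ℝ}

theorem ext_uSol (hr : 0 < r) (hp : 0 < p) (v : C(unitInterval, ℝ)) {x : ℝ}
    (hx : x ∈ Icc (0 : ℝ) 1) : ext (uSol lam hr hp v) x = green (rhs p r lam v) x :=
  ext_greenC _ hx

theorem uSol_nonneg (hr : 0 < r) (hp : 0 < p) (hl : 0 < lam) (v : C(unitInterval, ℝ)) (x : ℝ) :
    0 ≤ ext (uSol (p := p) lam hr hp v) x :=
  green_nonneg (fun _ _ => rhs_nonneg hl v _) (projIcc (0 : ℝ) 1 zero_le_one x).2

/-- The symmetry of Green's operator turns the derivative of the power terms into an integral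
against `-h''`. -/
theorem integral_rhs_mul_toC (hr : 0 < r) (hp : 0 < p) (v : C(unitInterval, ℝ)) (h : X q) :
    ∫ x in Ioo (0 : ℝ) 1, rhs p r lam v x * ext h.toC x
      = ∫ x in Ioo (0 : ℝ) 1, ext (uSol (p := p) lam hr hp v) x * -(D2 q h x) := by
  have h1 := integral_green_mul (integrable_of_continuous (continuous_rhs (p := p) lam hr hp v))
    (integrable_Lp (-D2 q h))
  calc _ = ∫ x in Ioo (0 : ℝ) 1, rhs p r lam v x * green (-D2 q h : Lp ℝ (expo q) mu) x := by
        refine setIntegral_congr_fun measurableSet_Ioo fun x hx => ?_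
        simp only [ext_toC_eq_green h (Ioo_subset_Icc_self hx)]
    _ = _ := h1.symm
    _ = _ := by
        refine integral_congr_ae ?_
        filter_upwards [Ioo_ae_mem, Lp.coeFn_neg (D2 q h)] with x hx h2
        rw [h2, ext_uSol hr hp v (Ioo_subset_Icc_self hx), Pi.neg_apply]

theorem continuous_uSol_rpow (hq : 0 < q) (hr : 0 < r) (hp : 0 < p) (v : C(unitInterval, ℝ)) :
    Continuous fun x => ext (uSol (p := p) lam hr hp v) x ^ q :=
  (continuous_ext _).rpow_const fun _ => Or.inr hq.le

theorem integrable_uSol_mul (hr : 0 < r) (hp : 0 < p) (v : C(unitInterval, ℝ)) {f : ℝ → ℝ}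
    (hf : Integrable f mu) : Integrable (fun x => ext (uSol (p := p) lam hr hp v) x * f x) mu :=
  hf.bdd_mul (c := ‖uSol (p := p) lam hr hp v‖) (continuous_ext _).aestronglyMeasurable
    (ae_of_all _ fun x => abs_ext_le _ x)

/-- The second equation of the system: the subgradient inequality, tested with the function `w`
with `-w'' = u^q`, is equality in Young's inequality. -/
theorem IsRayCritical.neg_D2_eq {v : X q} (H : IsRayCritical p q r lam v) (hq : 0 < q)
    (hr : 0 < r) (hp : 0 < p) (hl : 0 < lam) :
    ∀ᵐ x ∂mu, -(D2 q v x) = ext (uSol (p := p) lam hr hp v.toC) x ^ q := by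
  set u := uSol (p := p) lam hr hp v.toC with hu
  have hW := memLp_of_continuous (continuous_uSol_rpow (lam := lam) hq hr hp v.toC) (expo q)
  set W : Lp ℝ (expo q) mu := hW.toLp with hWdef
  have hWx : ∀ᵐ x ∂mu, W x = ext u x ^ q := hW.coeFn_toLp
  have hsub := H.subgradient hq hr hp hl (solve W)
  rw [integral_rhs_mul_toC hr hp, X.norm_def, X.norm_def, D2_solve, norm_neg, norm_rpow_eq hq,
    norm_rpow_eq hq, ← integral_const_mul, ← integral_const_mul, ← hu] at hsub
  set F : (ℝ → ℝ) → ℝ → ℝ := fun f x =>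
    q / (q + 1) * |f x| ^ ((q + 1) / q) - ext u x * f x with hF
  have iv := integrable_abs_rpow hq (D2 q v)
  have iW := integrable_abs_rpow hq W
  have juv : Integrable (fun x => ext u x * -(D2 q v x)) mu :=
    integrable_uSol_mul hr hp v.toC (integrable_Lp (D2 q v)).neg
  have juW := integrable_uSol_mul (lam := lam) hr hp v.toC (integrable_Lp W)
  rw [← hu] at juW
  have iFW : Integrable (F W) mu := (iW.const_mul _).sub juW
  have iFv : Integrable (F fun x => -(D2 q v x)) mu := by
    have := (iv.const_mul (q / (q + 1))).sub juv
    refine this.congr (ae_of_all _ fun x => ?_)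
    simp [hF]
  have e1 : ∫ x in Ioo (0 : ℝ) 1, ext u x * -(D2 q (solve W - v) x)
      = (∫ x in Ioo (0 : ℝ) 1, ext u x * W x) - ∫ x in Ioo (0 : ℝ) 1, ext u x * -(D2 q v x) := by
    rw [← integral_sub juW juv]
    refine integral_congr_ae ?_
    rw [map_sub, D2_solve]
    filter_upwards [Lp.coeFn_sub (-W) (D2 q v), Lp.coeFn_neg W] with x h1 h2
    simp only [h1, Pi.sub_apply, h2, Pi.neg_apply]
    ring
  have e2 : ∫ x in Ioo (0 : ℝ) 1, F W x = (∫ x in Ioo (0 : ℝ) 1, q / (q + 1) *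
      |W x| ^ ((q + 1) / q)) - ∫ x in Ioo (0 : ℝ) 1, ext u x * W x :=
    integral_sub (iW.const_mul _) juW
  have e3 : ∫ x in Ioo (0 : ℝ) 1, F (fun x => -(D2 q v x)) x = (∫ x in Ioo (0 : ℝ) 1,
      q / (q + 1) * |D2 q v x| ^ ((q + 1) / q)) - ∫ x in Ioo (0 : ℝ) 1, ext u x * -(D2 q v x) := by
    simp only [hF, abs_neg]
    exact integral_sub (iv.const_mul _) juv
  have hle : ∀ᵐ x ∂mu, F W x ≤ F (fun x => -(D2 q v x)) x := by
    filter_upwards [hWx] with x hx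
    have hu0 : 0 ≤ ext u x := uSol_nonneg hr hp hl v.toC x
    have := abs_rpow_tangent hq (ext u x ^ q) (-(D2 q v x))
    rw [oddPow_rpow hq hu0] at this
    simp only [hF, hx]
    linarith
  have hint : ∫ x in Ioo (0 : ℝ) 1, (F (fun x => -(D2 q v x)) x - F W x) = 0 := by
    refine le_antisymm ?_ (integral_nonneg_of_ae ?_)
    · rw [integral_sub iFv iFW, e2, e3]
      linarith
    · filter_upwards [hle] with x hx
      exact sub_nonneg.2 hx
  have hae := (integral_eq_zero_iff_of_nonneg_ae (by
    filter_upwards [hle] with x hx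
    exact sub_nonneg.2 hx) (iFv.sub iFW)).1 hint
  filter_upwards [hae, hWx] with x hx hWx
  refine eq_rpow_of_le hq (uSol_nonneg hr hp hl v.toC x) ?_
  have : F (fun x => -(D2 q v x)) x - F W x = 0 := hx
  simp only [hF, hWx] at this
  exact (sub_eq_zero.1 this).le

theorem abs_rpow_sub_one_mul {m y : ℝ} (hm : 0 < m) (hy : 0 ≤ y) : |y| ^ (m - 1) * y = y ^ m := by
  rcases hy.eq_or_lt with rfl | hy'
  · rw [mul_zero, Real.zero_rpow hm.ne']
  · rw [abs_of_nonneg hy, Real.rpow_sub_one hy'.ne', div_mul_cancel₀ _ hy'.ne']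

/-- Critical points are solutions. -/
theorem IsRayCritical.isNonnegClassicalSol {v : X q} (H : IsRayCritical p q r lam v) (hq : 0 < q)
    (hr : 0 < r) (hp : 0 < p) (hl : 0 < lam) :
    IsNonnegClassicalSol p q r lam (uSol (p := p) lam hr hp v.toC) v.toC := by
  have hD := H.neg_D2_eq hq hr hp hl
  set u := uSol (p := p) lam hr hp v.toC with hu
  have cu : Continuous fun x => ext u x ^ q := continuous_uSol_rpow hq hr hp v.toC
  have cr := continuous_rhs (p := p) lam hr hp v.toC
  have hu0 : ∀ x, 0 ≤ ext u x := uSol_nonneg hr hp hl v.toC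
  have eu : EqOn (ext u) (green (rhs p r lam v.toC)) (Ioo 0 1) := fun x hx =>
    ext_uSol hr hp v.toC (Ioo_subset_Icc_self hx)
  have ev : EqOn (ext v.toC) (green fun x => ext u x ^ q) (Ioo 0 1) := fun x hx => by
    rw [ext_toC_eq_green v (Ioo_subset_Icc_self hx)]
    refine congrFun (green_congr ?_) x
    filter_upwards [hD, Lp.coeFn_neg (D2 q v)] with y h1 h2
    rw [h2, Pi.neg_apply, h1]
  have hv0 : ∀ x ∈ Ioo (0 : ℝ) 1, 0 ≤ ext v.toC x := fun x hx => by
    rw [ev hx]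
    exact green_nonneg (fun y _ => Real.rpow_nonneg (hu0 y) q) (Ioo_subset_Icc_self hx)
  have hderiv : ∀ {f g : ℝ → ℝ}, Continuous g → EqOn f (green g) (Ioo 0 1) →
      ∀ x ∈ Ioo (0 : ℝ) 1, -deriv (deriv f) x = g x := fun {f g} hg hfg x hx => by
    have h1 : f =ᶠ[𝓝 x] green g := hfg.eventuallyEq_of_mem (isOpen_Ioo.mem_nhds hx)
    rw [h1.deriv.deriv_eq, (hasDerivAt_deriv_green hg hx).deriv, neg_neg]
  refine ⟨(contDiffOn_green cr).congr eu, (contDiffOn_green cu).congr ev, fun x _ => hu0 x, hv0,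
    fun x hx => ?_, fun x hx => ?_, green_zero _, green_one _, v.2.1, v.2.2.1⟩
  · rw [hderiv cr eu x hx, rhs, abs_rpow_sub_one_mul hr (hv0 x hx),
      abs_rpow_sub_one_mul hp (hv0 x hx), max_eq_left (hv0 x hx)]
  · rw [hderiv cu ev x hx, abs_rpow_sub_one_mul hq (hu0 x)]

/-- Critical points are critical in the sense of Fréchet; the second derivative being bounded there,
the leading term is differentiable at them by a pointwise estimate. -/
theorem IsRayCritical.hasFDerivAt {v : X q} (H : IsRayCritical p q r lam v) (hq : 0 < q)
    (hr : 0 < r) (hp : 0 < p) (hl : 0 < lam) :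
    HasFDerivAt (J p q r lam) (0 : X q →L[ℝ] ℝ) v := by
  have hD := H.neg_D2_eq hq hr hp hl
  set u := uSol (p := p) lam hr hp v.toC with hu
  have hu0 : ∀ x, 0 ≤ ext u x := uSol_nonneg hr hp hl v.toC
  have hs : 1 < (q + 1) / q := by rw [lt_div_iff₀ hq]; linarith
  rw [hasFDerivAt_iff_isLittleO_nhds_zero, Asymptotics.isLittleO_iff]
  intro c hc
  set c' := c / (2 + lam / (r + 1) + 1 / (p + 1)) with hc'
  have hden : 0 < 2 + lam / (r + 1) + 1 / (p + 1) := by positivity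
  have hc'0 : 0 < c' := by positivity
  obtain ⟨C, hC, hφ⟩ := exists_abs_rpow_sub_le hq (‖u‖ ^ q) hc'0
  have hsmall : ∀ᶠ h : X q in 𝓝 0, C * ‖h‖ ^ ((q + 1) / q - 1) < c' := by
    have : Continuous fun h : X q => C * ‖h‖ ^ ((q + 1) / q - 1) :=
      (continuous_norm.rpow_const fun _ => Or.inr (by linarith)).const_mul _
    refine (this.tendsto 0).eventually_lt_const ?_
    rw [norm_zero, Real.zero_rpow (by linarith), mul_zero]
    exact hc'0
  filter_upwards [hsmall, posInt_sub_isLittleO hr v hc'0, posInt_sub_isLittleO hp v hc'0]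
    with h h1 h2 h3
  have i0 := integrable_abs_rpow hq (D2 q (v + h))
  have i1 := integrable_abs_rpow hq (D2 q v)
  have i2 : Integrable (fun x => ext u x * -(D2 q h x)) mu :=
    integrable_uSol_mul hr hp v.toC (integrable_Lp (D2 q h)).neg
  have i3 := integrable_abs_rpow hq (D2 q h)
  have i4 := (integrable_Lp (D2 q h)).abs
  set E : ℝ → ℝ := fun x => q / (q + 1) * |D2 q (v + h) x| ^ ((q + 1) / q)
    - q / (q + 1) * |D2 q v x| ^ ((q + 1) / q) - ext u x * -(D2 q h x) with hE
  have i01 : Integrable (fun x => q / (q + 1) * |D2 q (v + h) x| ^ ((q + 1) / q)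
    - q / (q + 1) * |D2 q v x| ^ ((q + 1) / q)) mu := (i0.const_mul _).sub (i1.const_mul _)
  have iE : Integrable E mu := i01.sub i2
  have hEint : q / (q + 1) * ‖v + h‖ ^ ((q + 1) / q) - q / (q + 1) * ‖v‖ ^ ((q + 1) / q)
      - (∫ x in Ioo (0 : ℝ) 1, ext u x * -(D2 q h x)) = ∫ x in Ioo (0 : ℝ) 1, E x := by
    rw [X.norm_def, X.norm_def, norm_rpow_eq hq, norm_rpow_eq hq, ← integral_const_mul,
      ← integral_const_mul, ← integral_sub (i0.const_mul _) (i1.const_mul _), ← integral_sub i01 i2]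
  have hadd : ∀ᵐ x ∂mu, |D2 q (v + h) x| = |ext u x ^ q + -(D2 q h x)| := by
    rw [map_add]
    filter_upwards [Lp.coeFn_add (D2 q v) (D2 q h), hD] with x hx hx'
    rw [hx, ← hx', Pi.add_apply, ← neg_add, abs_neg]
  have habs : ∀ᵐ x ∂mu, |D2 q v x| = |ext u x ^ q| := by
    filter_upwards [hD] with x hx
    rw [← hx, abs_neg]
  have hE0 : 0 ≤ ∫ x in Ioo (0 : ℝ) 1, E x := by
    refine integral_nonneg_of_ae ?_
    filter_upwards [hadd, habs] with x hx hx'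
    have := abs_rpow_tangent hq (ext u x ^ q) (ext u x ^ q + -(D2 q h x))
    rw [oddPow_rpow hq (hu0 x), add_sub_cancel_left] at this
    simp only [hE, hx, hx', Pi.zero_apply]
    linarith
  have hE1 : ∫ x in Ioo (0 : ℝ) 1, E x ≤ 2 * c' * ‖h‖ := by
    calc _ ≤ ∫ x in Ioo (0 : ℝ) 1, (c' * |D2 q h x| + C * |D2 q h x| ^ ((q + 1) / q)) := by
          refine integral_mono_ae iE ((i4.const_mul _).add (i3.const_mul _)) ?_
          filter_upwards [hadd, habs] with x hx hx'
          have h4 : |ext u x ^ q| ≤ ‖u‖ ^ q := by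
            rw [abs_of_nonneg (Real.rpow_nonneg (hu0 x) q)]
            exact Real.rpow_le_rpow (hu0 x) ((le_abs_self _).trans (abs_ext_le u x)) hq.le
          have := hφ (ext u x ^ q) (-(D2 q h x)) h4
          rw [oddPow_rpow hq (hu0 x), abs_neg] at this
          simp only [hE, hx, hx']
          exact this
      _ = c' * (∫ x in Ioo (0 : ℝ) 1, |D2 q h x|) + C * ‖h‖ ^ ((q + 1) / q) := by
          rw [integral_add (i4.const_mul _) (i3.const_mul _), integral_const_mul,
            integral_const_mul, X.norm_def, norm_rpow_eq hq]
      _ ≤ c' * ‖h‖ + c' * ‖h‖ := by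
          refine add_le_add (mul_le_mul_of_nonneg_left (integral_abs_le_norm _) hc'0.le) ?_
          rcases (norm_nonneg h).eq_or_lt with h0 | h0
          · rw [← h0, Real.zero_rpow (by positivity), mul_zero, mul_zero]
          · have e : ‖h‖ ^ ((q + 1) / q) = ‖h‖ ^ ((q + 1) / q - 1) * ‖h‖ := by
              rw [Real.rpow_sub_one h0.ne', div_mul_cancel₀ _ h0.ne']
            rw [e, ← mul_assoc]
            exact mul_le_mul_of_nonneg_right h1.le h0.le
      _ = _ := by ring
  have hrhs := integral_rhs_mul_toC (lam := lam) hr hp v.toC h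
  rw [integral_rhs_mul lam hr hp, ← hu] at hrhs
  rw [zero_apply, sub_zero, J_eq hq, J_eq hq, Real.norm_eq_abs]
  set a := ∫ x in Ioo (0 : ℝ) 1, (max (ext v.toC x) 0) ^ r * ext h.toC x
  set b := ∫ x in Ioo (0 : ℝ) 1, (max (ext v.toC x) 0) ^ p * ext h.toC x
  set R := posInt (r + 1) (v + h).toC - posInt (r + 1) v.toC - (r + 1) * a with hR
  set S := posInt (p + 1) (v + h).toC - posInt (p + 1) v.toC - (p + 1) * b with hS
  have key : q / (q + 1) * ‖v + h‖ ^ ((q + 1) / q) - lam / (r + 1) * posInt (r + 1) (v + h).toC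
        - 1 / (p + 1) * posInt (p + 1) (v + h).toC
      - (q / (q + 1) * ‖v‖ ^ ((q + 1) / q) - lam / (r + 1) * posInt (r + 1) v.toC
        - 1 / (p + 1) * posInt (p + 1) v.toC)
      = (∫ x in Ioo (0 : ℝ) 1, E x) - lam / (r + 1) * R - 1 / (p + 1) * S := by
    rw [← hEint, ← hrhs, hR, hS]
    field_simp
    ring
  rw [key]
  have k1 : |lam / (r + 1) * R| ≤ lam / (r + 1) * (c' * ‖h‖) := by
    rw [abs_mul, abs_of_nonneg (by positivity : 0 ≤ lam / (r + 1))]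
    gcongr
  have k2 : |1 / (p + 1) * S| ≤ 1 / (p + 1) * (c' * ‖h‖) := by
    rw [abs_mul, abs_of_nonneg (by positivity : 0 ≤ 1 / (p + 1))]
    gcongr
  have k3 : c * ‖h‖ = 2 * c' * ‖h‖ + lam / (r + 1) * (c' * ‖h‖) + 1 / (p + 1) * (c' * ‖h‖) := by
    have : c = c' * (2 + lam / (r + 1) + 1 / (p + 1)) := by
      rw [hc', div_mul_cancel₀ _ hden.ne']
    rw [this]
    ring
  rw [k3]
  obtain ⟨k1a, k1b⟩ := abs_le.1 k1
  obtain ⟨k2a, k2b⟩ := abs_le.1 k2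
  rw [abs_le]
  constructor
  · have : 0 ≤ 2 * c' * ‖h‖ := by positivity
    linarith
  · linarith

end critical

/-! ### The mountain pass -/

theorem eventually_smul_add {q : ℝ} {P : X q → Prop} (hP : IsOpen {w | P w}) (τ : ℝ) (v h : X q)
    (h0 : P (τ • v)) : ∀ᶠ ε : ℝ in 𝓝[>] 0, P (τ • (v + ε • h)) := by
  have hc : Continuous fun ε : ℝ => τ • (v + ε • h) := by fun_prop
  refine (hc.tendsto 0).eventually ?_ |>.filter_mono nhdsWithin_le_nhds
  rw [zero_smul, add_zero]
  exact hP.mem_nhds h0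

/-- An interior minimizer on a ball satisfies the definition with `τ = 1`. -/
theorem isRayCritical_of_isMinOn {p q r lam T : ℝ} {v : X q} (hv : v ∈ Metric.ball (0 : X q) T)
    (hmin : IsMinOn (J p q r lam) (Metric.closedBall 0 T) v) : IsRayCritical p q r lam v := by
  intro h η hη
  have := eventually_smul_add (P := fun w => w ∈ Metric.ball (0 : X q) T) Metric.isOpen_ball 1 v h
    (by rwa [one_smul])
  filter_upwards [this] with ε hε
  refine ⟨1, by simpa using hη, ?_⟩
  rw [one_smul]
  exact hmin (Metric.ball_subset_closedBall hε)

namespace Geometry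

variable {p q r lam T : ℝ} (G : Geometry p q r lam T)
include G

/-- A minimizer of the energy on the Nehari set is critical: the Nehari set meets every ray close to
its own ray, at a nearby parameter. -/
theorem isRayCritical_of_min {v : X q} (hv : v ∈ NehariSet p q r lam T)
    (hmin : ∀ w ∈ NehariSet p q r lam T, J p q r lam v ≤ J p q r lam w) :
    IsRayCritical p q r lam v := by
  intro h η hη
  have hn := G.T_pos.trans (G.norm_gt hv)
  have hlt : T / ‖v‖ < 1 := (div_lt_one hn).2 (G.norm_gt hv)
  have hTv : 0 < T / ‖v‖ := div_pos G.T_pos hn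
  -- the Nehari functional is positive at `(1 - κ) v` and negative at `(1 + κ) v`, hence also at
  -- `(1 - κ) (v + ε h)` and `(1 + κ) (v + ε h)` for small `ε`
  set κ := min (η / 2) (1 - T / ‖v‖) with hκ
  have hκ0 : 0 < κ := lt_min (by linarith) (by linarith)
  have hκ1 : κ ≤ η / 2 := min_le_left _ _
  have hκ2 : κ ≤ 1 - T / ‖v‖ := min_le_right _ _
  have hN := G.nehari_continuous
  have h1 := eventually_smul_add (P := fun w => 0 < nehari p q r lam w)
    (isOpen_lt continuous_const hN) (1 - κ) v h
    (G.nehari_smul_pos hv (by linarith) (by linarith))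
  have h2 := eventually_smul_add (P := fun w => nehari p q r lam w < 0)
    (isOpen_lt hN continuous_const) (1 + κ) v h (G.nehari_smul_neg hv (by linarith))
  have h3 := eventually_smul_add (P := fun w => T < ‖w‖)
    (isOpen_lt continuous_const continuous_norm) (1 + κ) v h (by
      rw [norm_smul, Real.norm_of_nonneg (by linarith)]
      exact (G.norm_gt hv).trans (lt_mul_of_one_lt_left hn (by linarith)))
  filter_upwards [h1, h2, h3] with ε h1 h2 h3
  obtain ⟨τ, hτ, hmem⟩ := G.exists_mem_nehariSet (g := fun τ : ℝ => τ • (v + ε • h)) (by fun_prop)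
    (by linarith : 1 - κ ≤ 1 + κ) (Or.inr h1.le) h3.le h2.le
  refine ⟨τ, ?_, (G.J_smul_le hv (by linarith [hτ.1])).trans (hmin _ hmem)⟩
  rw [abs_lt]
  constructor <;> linarith [hτ.1, hτ.2]

/-- A minimizer on the Nehari set is a mountain pass point: the ray through it is an optimal path,
as every path to a point beyond the Nehari set meets that set. -/
theorem isMountainPass_of_min {v : X q} (hv : v ∈ NehariSet p q r lam T)
    (hmin : ∀ w ∈ NehariSet p q r lam T, J p q r lam v ≤ J p q r lam w) :
    ∃ e : X q, J p q r lam e < 0 ∧ IsMountainPass (J p q r lam) T e v := by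
  have hpos : 0 < posInt (p + 1) v.toC :=
    (half_pos (Real.rpow_pos_of_pos G.T_pos _)).trans_le (G.posInt_ge hv)
  obtain ⟨R, ⟨hT, hJ, hN⟩, hR⟩ := ((G.eventually_neg hpos).and (eventually_gt_atTop 1)).exists
  refine ⟨R • v, hJ, ⟨G.T_pos, hT⟩, ⟨_, ?_, hJ.trans G.energy_pos, G.energy⟩,
    (G.isRayCritical_of_min hv hmin).hasFDerivAt G.q_pos G.r_pos G.p_pos G.lam_pos,
    IsLeast.isGLB ⟨?_, ?_⟩⟩
  · rw [J_zero G.q_pos G.r_pos G.p_pos]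
    exact G.energy_pos
  · let γ : Path (0 : X q) (R • v) :=
      { toFun := fun t => (t : ℝ) • R • v
        continuous_toFun := by fun_prop
        source' := by simp
        target' := by simp }
    have hγ : ∀ t, γ t = (t : ℝ) • R • v := fun _ => rfl
    refine ⟨γ, ⟨⟨R⁻¹, by positivity, inv_le_one_of_one_le₀ hR.le⟩, ?_⟩, ?_⟩
    · simp only [hγ]
      rw [smul_smul, inv_mul_cancel₀ (by positivity), one_smul]
    · rintro _ ⟨t, rfl⟩
      simp only [hγ, smul_smul]
      exact G.J_smul_le hv (mul_nonneg t.2.1 (by linarith))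
  · rintro m ⟨γ, hm⟩
    obtain ⟨t, ht, hmem⟩ := G.exists_mem_nehariSet (g := γ.extend) γ.continuous_extend zero_le_one
      (Or.inl (by simpa using G.T_pos.le)) (by simpa using hT.le) (by simpa using hN.le)
    rw [γ.extend_apply ht] at hmem
    exact (hmin _ hmem).trans (hm.2 ⟨_, rfl⟩)

end Geometry

end HamSys
end

theorem theorem1p1 (p q r : ℝ) (hq : 0 < q) (hr : 0 < r) (hrq : r < 1 / q)
    (hp : max 1 (1 / q) < p) :
    ∃ lam₀ T : ℝ, 0 < lam₀ ∧ 0 < T ∧ ∀ lam : ℝ, 0 < lam → lam < lam₀ →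
      ∃ (u₁ u₂ : C(unitInterval, ℝ)) (v₁ v₂ : HamSys.X q),
        HamSys.IsNonnegClassicalSol p q r lam u₁ v₁.toC ∧
        HamSys.IsNonnegClassicalSol p q r lam u₂ v₂.toC ∧
        (u₁, v₁.toC) ≠ (0, 0) ∧ (u₂, v₂.toC) ≠ (0, 0) ∧ (u₁, v₁.toC) ≠ (u₂, v₂.toC) ∧
        (∃ e : HamSys.X q, HamSys.J p q r lam e < 0 ∧
          HamSys.IsMountainPass (HamSys.J p q r lam) T e v₁) ∧
        0 < HamSys.J p q r lam v₁ ∧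
        v₂ ∈ Metric.ball (0 : HamSys.X q) T ∧
        IsMinOn (HamSys.J p q r lam) (Metric.closedBall 0 T) v₂ ∧
        IsLocalMin (HamSys.J p q r lam) v₂ ∧
        HamSys.J p q r lam v₂ < 0 := by
  have hs : (q + 1) / q = 1 / q + 1 := by field_simp; ring
  have hqp : 1 / q < p := (le_max_right _ _).trans_lt hp
  have hp0 : 0 < p := lt_trans (by positivity) hqp
  obtain ⟨lam₀, T, hlam₀, hT, hG⟩ := HamSys.exists_geometry (p := p) hq hr
    (by rw [hs]; linarith) (by rw [hs]; linarith)
  refine ⟨lam₀, T, hlam₀, hT, fun lam hl hl' => ?_⟩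
  have G := hG lam hl hl'
  obtain ⟨v₁, hv₁, hmin₁⟩ := G.exists_min_nehariSet
  obtain ⟨v₂, hv₂, hmin₂⟩ := G.exists_min_closedBall
  obtain ⟨w, hw, hJw⟩ := G.exists_J_neg
  have hJ₁ : 0 < HamSys.J p q r lam v₁ := G.energy_pos.trans_le (G.J_ge hv₁)
  have hJ₂ : HamSys.J p q r lam v₂ < 0 := (hmin₂ hw).trans_lt hJw
  have hball : v₂ ∈ Metric.ball (0 : HamSys.X q) T := by
    rw [mem_closedBall_zero_iff] at hv₂
    rw [mem_ball_zero_iff]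
    refine lt_of_le_of_ne hv₂ fun h => ?_
    linarith [G.energy v₂ h, G.energy_pos]
  have hcrit₁ := G.isRayCritical_of_min hv₁ hmin₁
  have hcrit₂ := HamSys.isRayCritical_of_isMinOn hball hmin₂
  have hJ0 : HamSys.J p q r lam (0 : HamSys.X q) = 0 := HamSys.J_zero hq hr hp0
  have hne : ∀ v v' : HamSys.X q, HamSys.J p q r lam v ≠ HamSys.J p q r lam v' →
      v.toC ≠ v'.toC := fun v v' h h' => h (by rw [HamSys.X.toC_injective h'])
  refine ⟨_, _, v₁, v₂, hcrit₁.isNonnegClassicalSol hq hr hp0 hl,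
    hcrit₂.isNonnegClassicalSol hq hr hp0 hl, fun h => ?_, fun h => ?_, fun h => ?_,
    G.isMountainPass_of_min hv₁ hmin₁, hJ₁, hball, hmin₂,
    hmin₂.isLocalMin (Filter.mem_of_superset (Metric.isOpen_ball.mem_nhds hball)
      Metric.ball_subset_closedBall), hJ₂⟩
  · exact hne v₁ 0 (by rw [hJ0]; exact hJ₁.ne') (Prod.ext_iff.1 h).2
  · exact hne v₂ 0 (by rw [hJ0]; exact hJ₂.ne) (Prod.ext_iff.1 h).2
  · exact hne v₁ v₂ (hJ₂.trans hJ₁).ne' (Prod.ext_iff.1 h).2
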